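/- \textbf{Notation.} For a symmetric positive semidefinite $A\in\mathbb R^{d\times d}$ with Moore--Penrose pseudoinverse $A^\dagger$ write $\|z\|_A=(z^TA^\dagger z)^{1/2}$. Let $n$ be even, let $H_1=\{1,\dots,n/2\}$ and $H_2=\{n/2+1,\dots,n\}$, and for $z_1,\dots,z_n\in\mathbb R^d$ and $H\in\{H_1,H_2\}$ put $\hat\Sigma_H=\frac1n\sum_{i\in H}z_iz_i^T$ (normalised by $n$). The data set $(z_i)_{i\le n}$ is \emph{$\beta$-norm bounded} if $z_i^T\hat\Sigma_H^\dagger z_i\le\beta^2$ for all $i\in\{1,\dots,n\}$ and both $H\in\{H_1,H_2\}$. \textbf{Lemma (Heavy-tailed norm-boundedness).} There is a universal constant $C>0$ such that the following holds for all $d\ge1$, all even $n$, all $\delta\in(0,1)$ and all real $b_{\mathsf{clip}}$ with $n\ge C\,b_{\mathsf{clip}}^2\log(2d/\delta)$. (a) Let $k>2$ and $m_k\ge0$ be real, and let $Z_1,\dots,Z_n$ be i.i.d. random vectors in $\mathbb R^d$ with $E\|Z_1\|^k<\infty$ and second-moment matrix $\Sigma=E[Z_1Z_1^T]$ (possibly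 singular) such that $E|v^TZ_1|^k\le m_k^k\,(v^T\Sigma v)^{k/2}$ for all $v\in\mathbb R^d$. Let $b_{\mathsf{clip}}\ge0$ be large enough that $m_k^2\,(m_k\sqrt d)^{k-2}\le\frac13\,b_{\mathsf{clip}}^{k-2}$. Let $\bar Z_i=c(Z_i)$, where $c:\mathbb R^d\to\mathbb R^d$ is measurable, $c(z)=z$ whenever $\|z\|_\Sigma\le b_{\mathsf{clip}}$, and, for every $z$, $\|c(z)\|_\Sigma\le b_{\mathsf{clip}}$ and $c(z)=tz$ for some $t\in[0,1]$ (for example $c(z)=z\,\mathbf 1\{\|z\|_\Sigma\le b_{\mathsf{clip}}\}$, or the radial projection to $\{\|z\|_\Sigma\le b_{\mathsf{clip}}\}$). Then with probability at least $1-2\delta$ the clipped sample $\bar Z_1,\dots,\bar Z_n$ is $\frac{3}{\sqrt2}b_{\mathsf{clip}}$-norm bounded, that is, $\bar Z_i^T\hat\Sigma_H^\dagger\bar Z_i\le\frac92 b_{\mathsf{clip}}^2$ for every $i$ and both halves $H$. (b) More generally, the same conclusion holds for all i.i.d. random vectors $\bar Z_1,\dots,\bar Z_n$ in $\mathbb R^d$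 with $E\|\bar Z_1\|^2<\infty$ and $\|\bar Z_1\|_{\bar\Sigma}\le\sqrt{3/2}\,b_{\mathsf{clip}}$ almost surely, where $\bar\Sigma=E[\bar Z_1\bar Z_1^T]$. -/

import Mathlib

open MeasureTheory ProbabilityTheory Matrix

noncomputable section

namespace HeavyTail

/-- The Moore-Penrose pseudoinverse `A†` of a symmetric real matrix: the function `x ↦ x⁻¹`
(with `0 ↦ 0`) applied to the eigenvalues of `A`. It is only used at symmetric matrices; the
Penrose equations are proved below. -/
def pinv {d : ℕ} (A : Matrix (Fin d) (Fin d) ℝ) : Matrix (Fin d) (Fin d) ℝ :=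
  cfc (fun x : ℝ => x⁻¹) A

/-- On symmetric matrices `pinv` satisfies the four Penrose equations, which characterise the
Moore-Penrose pseudoinverse. -/
theorem pinv_penrose {d : ℕ} (A : Matrix (Fin d) (Fin d) ℝ) (hA : A.IsHermitian) :
    A * pinv A * A = A ∧ pinv A * A * pinv A = pinv A ∧
      (A * pinv A).IsHermitian ∧ (pinv A * A).IsHermitian := by
  have hA' : IsSelfAdjoint A := hA
  have hc : ∀ f : ℝ → ℝ, ContinuousOn f (spectrum ℝ A) := fun f =>
    (Matrix.finite_real_spectrum (A := A)).continuousOn f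
  have h1 : A * pinv A = cfc (fun x : ℝ => x * x⁻¹) A := by
    rw [cfc_mul (fun x : ℝ => x) (fun x : ℝ => x⁻¹) A (hc _) (hc _), cfc_id' ℝ A]
    rfl
  have h2 : pinv A * A = cfc (fun x : ℝ => x⁻¹ * x) A := by
    rw [cfc_mul (fun x : ℝ => x⁻¹) (fun x : ℝ => x) A (hc _) (hc _), cfc_id' ℝ A]
    rfl
  refine ⟨?_, ?_, ?_, ?_⟩
  · rw [h1]
    conv_lhs => arg 2; rw [← cfc_id' ℝ A]
    rw [← cfc_mul _ _ A (hc _) (hc _)]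
    refine (cfc_congr fun x _ => ?_).trans (cfc_id' ℝ A)
    exact mul_inv_mul_cancel x
  · rw [h2]
    unfold pinv
    rw [← cfc_mul _ _ A (hc _) (hc _)]
    refine cfc_congr fun x _ => ?_
    by_cases hx : x = 0 <;> simp [hx]
  · rw [h1]
    exact cfc_predicate (R := ℝ) _ A
  · rw [h2]
    exact cfc_predicate (R := ℝ) _ A

/-- The norm `‖z‖_A = (zᵀ A† z)^{1/2}` induced by a positive semidefinite matrix `A`. -/
def psdNorm {d : ℕ} (A : Matrix (Fin d) (Fin d) ℝ) (z : Fin d → ℝ) : ℝ :=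
  √(z ⬝ᵥ pinv A *ᵥ z)

/-- The second-moment matrix `E[Z Zᵀ]` of a law `P` on `ℝᵈ`. -/
def secondMoment {d : ℕ} (P : Measure (Fin d → ℝ)) : Matrix (Fin d) (Fin d) ℝ :=
  Matrix.of fun i j => ∫ z, z i * z j ∂P

/-- `Σ̂_H = (1/n) ∑_{i ∈ H} z_i z_iᵀ`, normalised by `n` and not by the size of `H`. -/
def scov {d n : ℕ} (z : Fin n → Fin d → ℝ) (H : Finset (Fin n)) : Matrix (Fin d) (Fin d) ℝ :=
  (1 / (n : ℝ)) • ∑ i ∈ H, vecMulVec (z i) (z i)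

/-- The first half `{1, …, n/2}` of the indices. -/
def firstHalf (n : ℕ) : Finset (Fin n) := Finset.univ.filter fun i => (i : ℕ) < n / 2

/-- The second half `{n/2 + 1, …, n}` of the indices. -/
def secondHalf (n : ℕ) : Finset (Fin n) := Finset.univ.filter fun i => n / 2 ≤ (i : ℕ)

/-- The data set `z` is `b`-norm bounded: `z_iᵀ Σ̂_H† z_i ≤ b²` for all `i` and both halves `H`. -/
def NormBounded {d n : ℕ} (z : Fin n → Fin d → ℝ) (b : ℝ) : Prop :=
  ∀ H : Finset (Fin n), H = firstHalf n ∨ H = secondHalf n →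
    ∀ i : Fin n, z i ⬝ᵥ pinv (scov z H) *ᵥ z i ≤ b ^ 2

/-- `Z` is an i.i.d. sample of size `n` from `P`, on the probability space `(Ω, μ)`. -/
def IsIIDSample {d n : ℕ} {Ω : Type*} [MeasurableSpace Ω] (Z : Fin n → Ω → Fin d → ℝ)
    (P : Measure (Fin d → ℝ)) (μ : Measure Ω) : Prop :=
  (∀ i, Measurable (Z i)) ∧ (∀ i, μ.map (Z i) = P) ∧ iIndepFun Z μ

/-- The law `P` has `k`-th moments bounded by `m`: it has a finite `k`-th absolute moment and, with
`Σ = E[Z Zᵀ]`, `E |⟨v, Z⟩|ᵏ ≤ mᵏ (vᵀ Σ v)^{k/2}` for all `v`. -/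
def HasMomentBound {d : ℕ} (P : Measure (Fin d → ℝ)) (k m : ℝ) : Prop :=
  MemLp (fun z : Fin d → ℝ => z) (ENNReal.ofReal k) P ∧
    ∀ v : Fin d → ℝ,
      ∫ z, |v ⬝ᵥ z| ^ k ∂P ≤ m ^ k * (v ⬝ᵥ secondMoment P *ᵥ v) ^ (k / 2)

/-- `c` clips vectors to the ball `{‖z‖_A ≤ b}`: it fixes the vectors of that ball, and rescales
every other vector by a factor in `[0, 1]` so that it lands in the ball. Both usual conventions
are covered: `z ↦ z · 1{‖z‖_A ≤ b}` and `z ↦ min(1, b / ‖z‖_A) z`. -/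
def IsClipping {d : ℕ} (A : Matrix (Fin d) (Fin d) ℝ) (b : ℝ)
    (c : (Fin d → ℝ) → Fin d → ℝ) : Prop :=
  Measurable c ∧ (∀ z, psdNorm A z ≤ b → c z = z) ∧
    ∀ z, psdNorm A (c z) ≤ b ∧ ∃ t : ℝ, 0 ≤ t ∧ t ≤ 1 ∧ c z = t • z

end HeavyTail

end

namespace HeavyTail

/-! Let `Σ` be the second moment of the law of the bounded sample. If `Σ ≼ 3 Σ̂_H`, then
Cauchy–Schwarz gives `zᵀ Σ̂_H† z ≤ 3 zᵀ Σ† z ≤ (9/2) b²` for `z` in the range of `Σ`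
(`dotProduct_pinv_mulVec_le`), and almost every sample point lies in that range. It remains to bound
`Σ̂_H` from below with high probability.

Whitening on the range of `Σ` (`exists_whitening`) turns the points into vectors `w` with identity
second moment and `|w|² ≤ L = (3/2) b²`, in dimension at most `d`. The bound is then a lower-tail
matrix Chernoff inequality (`measure_exists_sum_lt_le`), proved without matrix exponentials. Its
potential is `tr Mʰ` with `M = 1 - ε ∑ w wᵀ` and `h = |H|`. Subtracting one more `ε w wᵀ` lowers it
by at least `8/9` of the first-order amount `ε h wᵀ Mʰ w` (`trace_pow_sub_vecMulVec_le`), and by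
independence `wᵀ Mʰ w` has the same mean as `tr Mʰ`. Each point thus multiplies the expected
potential by at most `1 - (8/9) ε h`. A bad direction forces a large eigenvalue of `M`, and Markov's
inequality concludes.

For clipped data, the moment bound shows that at most a third of the second moment is lost in any
direction (`dotProduct_secondMoment_mulVec_le_map`). Hence norm at most `b` for the original second
moment becomes norm at most `√(3/2) b` for the clipped one. -/

theorem dotProduct_self_nonneg_real {ι : Type*} [Fintype ι] (v : ι → ℝ) : 0 ≤ v ⬝ᵥ v :=
  Finset.sum_nonneg fun _ _ => mul_self_nonneg _

/-! ### Spectral moments and the trace potential under a rank-one update -/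

section Deterministic

variable {ι : Type*} [Fintype ι] [DecidableEq ι]

/-- The moments `v ⬝ᵥ Mʲ v` of a symmetric matrix are the moments of a spectral measure. -/
theorem exists_spectral_weights (M : Matrix ι ι ℝ) (hM : M.IsHermitian) (v : ι → ℝ) :
    ∃ μ : ι → ℝ, (∀ i, 0 ≤ μ i) ∧ ∀ j : ℕ, v ⬝ᵥ (M ^ j) *ᵥ v = ∑ i, μ i * hM.eigenvalues i ^ j := by
  set U : Matrix ι ι ℝ := (hM.eigenvectorUnitary : Matrix ι ι ℝ) with hU
  have hUU : star U * U = 1 := by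
    simp [hU]
  have hUU' : U * star U = 1 := by
    simp [hU]
  have hs : M = U * diagonal hM.eigenvalues * star U := by
    have := hM.spectral_theorem
    rw [Unitary.conjStarAlgAut_apply] at this
    simpa using this
  have hpow : ∀ j : ℕ, M ^ j = U * diagonal (fun i => hM.eigenvalues i ^ j) * star U := by
    intro j
    induction j with
    | zero => simp [hUU']
    | succ j ih =>
      rw [pow_succ, ih]
      calc _ = (U * diagonal (fun i => hM.eigenvalues i ^ j) * star U) *
            (U * diagonal hM.eigenvalues * star U) := by rw [← hs]
        _ = U * diagonal (fun i => hM.eigenvalues i ^ j) * (star U * U) *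
            diagonal hM.eigenvalues * star U := by noncomm_ring
        _ = _ := by
          rw [hUU, mul_one, mul_assoc U, diagonal_mul_diagonal]
          simp [pow_succ]
  refine ⟨fun i => (star U *ᵥ v) i ^ 2, fun i => sq_nonneg _, fun j => ?_⟩
  rw [hpow, ← mulVec_mulVec, ← mulVec_mulVec, dotProduct_mulVec]
  have : v ᵥ* U = star U *ᵥ v := by
    rw [star_eq_conjTranspose, conjTranspose_eq_transpose_of_trivial, mulVec_transpose]
  rw [this]
  simp only [dotProduct, mulVec_diagonal]
  exact Finset.sum_congr rfl fun i _ => by ring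

theorem moment_nonneg {M : Matrix ι ι ℝ} (hM : M.PosSemidef) (v : ι → ℝ) (j : ℕ) :
    0 ≤ v ⬝ᵥ (M ^ j) *ᵥ v := by
  obtain ⟨μ, hμ, h⟩ := exists_spectral_weights M hM.isHermitian v
  rw [h]
  exact Finset.sum_nonneg fun i _ => mul_nonneg (hμ i) (pow_nonneg (hM.eigenvalues_nonneg i) _)

/-- Chebyshev's inequality for the moments of a positive semidefinite matrix. -/
theorem moment_mul_moment_le {M : Matrix ι ι ℝ} (hM : M.PosSemidef) (v : ι → ℝ) (p q : ℕ) :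
    (v ⬝ᵥ (M ^ p) *ᵥ v) * (v ⬝ᵥ (M ^ q) *ᵥ v) ≤ (v ⬝ᵥ v) * (v ⬝ᵥ (M ^ (p + q)) *ᵥ v) := by
  obtain ⟨μ, hμ, h⟩ := exists_spectral_weights M hM.isHermitian v
  have h0 : v ⬝ᵥ v = ∑ i, μ i := by simpa using h 0
  set y := hM.isHermitian.eigenvalues
  have hy : ∀ i, 0 ≤ y i := hM.eigenvalues_nonneg
  rw [h0, h, h, h]
  -- The powers `yᵖ` and `y^q` are ordered alike on `y ≥ 0`; averaging this product over pairs with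
  -- weights `μ i * μ j` gives twice the claim.
  have key : ∀ i j, 0 ≤ (y i ^ p - y j ^ p) * (y i ^ q - y j ^ q) := by
    intro i j
    rcases le_total (y i) (y j) with hij | hij
    · exact mul_nonneg_of_nonpos_of_nonpos
        (sub_nonpos.2 (pow_le_pow_left₀ (hy i) hij p)) (sub_nonpos.2 (pow_le_pow_left₀ (hy i) hij q))
    · exact mul_nonneg
        (sub_nonneg.2 (pow_le_pow_left₀ (hy j) hij p)) (sub_nonneg.2 (pow_le_pow_left₀ (hy j) hij q))
  have e1 : (0 : ℝ) ≤ ∑ i, ∑ j, μ i * μ j * ((y i ^ p - y j ^ p) * (y i ^ q - y j ^ q)) :=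
    Finset.sum_nonneg fun i _ => Finset.sum_nonneg fun j _ =>
      mul_nonneg (mul_nonneg (hμ i) (hμ j)) (key i j)
  have e2 : ∑ i, ∑ j, μ i * μ j * ((y i ^ p - y j ^ p) * (y i ^ q - y j ^ q)) =
      (∑ i, μ i * y i ^ (p + q)) * (∑ i, μ i) + (∑ i, μ i) * (∑ i, μ i * y i ^ (p + q))
      - (∑ i, μ i * y i ^ p) * (∑ i, μ i * y i ^ q)
      - (∑ i, μ i * y i ^ q) * (∑ i, μ i * y i ^ p) := by
    simp only [Finset.sum_mul_sum, ← Finset.sum_add_distrib, ← Finset.sum_sub_distrib]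
    exact Finset.sum_congr rfl fun i _ => Finset.sum_congr rfl fun j _ => by ring
  nlinarith [e1, e2]

theorem eigenvalues_mem_Icc {M : Matrix ι ι ℝ} (hM : M.IsHermitian) {a c : ℝ}
    (ha : ∀ v, a * (v ⬝ᵥ v) ≤ v ⬝ᵥ M *ᵥ v) (hc : ∀ v, v ⬝ᵥ M *ᵥ v ≤ c * (v ⬝ᵥ v)) (i : ι) :
    hM.eigenvalues i ∈ Set.Icc a c := by
  set v : ι → ℝ := (hM.eigenvectorBasis i).ofLp
  have hv : v ⬝ᵥ v = 1 := by
    have h1 : inner ℝ (hM.eigenvectorBasis i) (hM.eigenvectorBasis i) = (1 : ℝ) := by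
      simp
    rw [EuclideanSpace.inner_eq_star_dotProduct] at h1
    simpa using h1
  have hMv : M *ᵥ v = hM.eigenvalues i • v := hM.mulVec_eigenvectorBasis i
  have h1 := ha v
  have h2 := hc v
  rw [hMv, dotProduct_smul, hv] at h1 h2
  simp at h1 h2
  exact ⟨h1, h2⟩

/-- If `v ⬝ᵥ M v` exceeds `a * (v ⬝ᵥ v)`, then `aᴺ` is a lower bound for `tr Mᴺ`. -/
theorem pow_le_trace_pow {M : Matrix ι ι ℝ} (hM : M.PosSemidef) {a : ℝ} (ha : 0 ≤ a) (v : ι → ℝ)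
    (hv : a * (v ⬝ᵥ v) < v ⬝ᵥ M *ᵥ v) (N : ℕ) : a ^ N ≤ (M ^ N).trace := by
  have hH := hM.isHermitian
  have hy := hM.eigenvalues_nonneg
  obtain ⟨i, hi⟩ : ∃ i, a < hH.eigenvalues i := by
    by_contra! hcon
    obtain ⟨μ, hμ, h⟩ := exists_spectral_weights M hH v
    have h0 : v ⬝ᵥ v = ∑ i, μ i := by simpa using h 0
    have h1 : v ⬝ᵥ M *ᵥ v = ∑ i, μ i * hH.eigenvalues i := by simpa using h 1
    rw [h0, h1, Finset.mul_sum] at hv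
    refine hv.not_ge (Finset.sum_le_sum fun i _ => ?_)
    nlinarith [hμ i, hcon i]
  have htr : (M ^ N).trace = ∑ j, (hH.eigenvectorBasis j).ofLp ⬝ᵥ (M ^ N) *ᵥ (hH.eigenvectorBasis j).ofLp := by
    set U : Matrix ι ι ℝ := (hH.eigenvectorUnitary : Matrix ι ι ℝ) with hU
    have hUU' : U * star U = 1 := by simp [hU]
    calc (M ^ N).trace = (star U * (M ^ N * U)).trace := by
          rw [trace_mul_comm, mul_assoc, hUU', mul_one]
      _ = _ := by
          refine Finset.sum_congr rfl fun j _ => ?_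
          simp [mul_apply, dotProduct, mulVec, hU]
  have hMv : ∀ j, ∀ K : ℕ, (M ^ K) *ᵥ (hH.eigenvectorBasis j).ofLp =
      hH.eigenvalues j ^ K • (hH.eigenvectorBasis j).ofLp := by
    intro j K
    induction K with
    | zero => simp
    | succ K ih =>
      rw [pow_succ, ← mulVec_mulVec, hH.mulVec_eigenvectorBasis j, mulVec_smul, ih, smul_smul, pow_succ,
        mul_comm]
  have hone : ∀ j, (hH.eigenvectorBasis j).ofLp ⬝ᵥ (hH.eigenvectorBasis j).ofLp = (1 : ℝ) := by
    intro j
    have h1 : inner ℝ (hH.eigenvectorBasis j) (hH.eigenvectorBasis j) = (1 : ℝ) := by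
      simp
    rw [EuclideanSpace.inner_eq_star_dotProduct] at h1
    simpa using h1
  rw [htr]
  simp only [hMv, dotProduct_smul, hone, smul_eq_mul, mul_one]
  calc a ^ N ≤ hH.eigenvalues i ^ N := pow_le_pow_left₀ ha hi.le N
    _ ≤ _ := Finset.single_le_sum (f := fun j => hH.eigenvalues j ^ N)
      (fun j _ => pow_nonneg (hy j) N) (Finset.mem_univ i)

/-- One step of the trace potential under a rank-one perturbation. -/
theorem trace_pow_sub_vecMulVec_le {M : Matrix ι ι ℝ} (hM : M.IsHermitian) {ε L : ℝ} {N : ℕ}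
    {w : ι → ℝ} (hlow : ∀ v, 9 / 10 * (v ⬝ᵥ v) ≤ v ⬝ᵥ M *ᵥ v) (hup : ∀ v, v ⬝ᵥ M *ᵥ v ≤ v ⬝ᵥ v)
    (hM' : (M - ε • vecMulVec w w).PosSemidef) (hε : 0 ≤ ε) (hw : w ⬝ᵥ w ≤ L)
    (hN : N * ε * L ≤ 1 / 10) :
    ((M - ε • vecMulVec w w) ^ N).trace ≤ (M ^ N).trace - 8 / 9 * ε * N * (w ⬝ᵥ (M ^ N) *ᵥ w) := by
  set M' := M - ε • vecMulVec w w with hM'def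
  have hMp : M.PosSemidef := .of_dotProduct_mulVec_nonneg hM fun v => by
    have h1 := hlow v
    have h2 : 0 ≤ v ⬝ᵥ v := dotProduct_self_nonneg_real v
    simp only [star_trivial]; linarith
  have heig := eigenvalues_mem_Icc hM hlow (c := 1) (by simpa using hup)
  have hw0 : 0 ≤ w ⬝ᵥ w := dotProduct_self_nonneg_real w
  set m : ℕ → ℝ := fun j => w ⬝ᵥ (M ^ j) *ᵥ w with hm
  have hm0 : ∀ j, 0 ≤ m j := moment_nonneg hMp w
  -- The spectrum of `M` lies in `[9/10, 1]`, so consecutive moments differ by at most a factor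
  -- `10/9`.
  have hms : ∀ j, m (j + 1) ≤ m j ∧ 9 / 10 * m j ≤ m (j + 1) := by
    intro j
    obtain ⟨μ, hμ, h⟩ := exists_spectral_weights M hM w
    simp only [hm, h, Finset.mul_sum]
    have hp : ∀ i, 0 ≤ μ i * hM.eigenvalues i ^ j := fun i =>
      mul_nonneg (hμ i) (pow_nonneg (hMp.eigenvalues_nonneg i) _)
    constructor <;> refine Finset.sum_le_sum fun i _ => ?_ <;>
      rw [pow_succ] <;> nlinarith [hp i, (heig i).1, (heig i).2]
  -- These mixed moments are the terms of the telescoping expansion of `tr Mᴺ - tr M'ᴺ`. Replacing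
  -- every `M'` by `M` would give the first-order term.
  set c : ℕ → ℕ → ℝ := fun p q => w ⬝ᵥ (M' ^ p * M ^ q) *ᵥ w with hc
  have hrank : ∀ (P Q : Matrix ι ι ℝ), w ⬝ᵥ (P * vecMulVec w w * Q) *ᵥ w =
      (w ⬝ᵥ P *ᵥ w) * (w ⬝ᵥ Q *ᵥ w) := by
    intro P Q
    rw [← mulVec_mulVec, ← mulVec_mulVec, vecMulVec_mulVec]
    rw [mulVec_smul, dotProduct_smul]
    simp
  have hrec : ∀ p q, c (p + 1) q = c p (q + 1) - ε * (c p 0 * m q) := by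
    intro p q
    have : M' ^ (p + 1) * M ^ q = M' ^ p * M ^ (q + 1) - ε • (M' ^ p * vecMulVec w w * M ^ q) := by
      rw [pow_succ, pow_succ']
      nth_rewrite 2 [hM'def]
      simp only [mul_sub, sub_mul, mul_smul_comm, smul_mul_assoc, mul_assoc]
    simp only [hc, hm, this, sub_mulVec, smul_mulVec, dotProduct_sub, dotProduct_smul, hrank,
      pow_zero, mul_one, smul_eq_mul]
  have hc0 : ∀ p, 0 ≤ c p 0 := fun p => by
    simpa [hc] using moment_nonneg hM' w p
  have hcle : ∀ p q, c p q ≤ m (p + q) := by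
    intro p
    induction p with
    | zero => intro q; simp [hc, hm]
    | succ p ih =>
      intro q
      rw [hrec]
      have h1 := ih (q + 1)
      have h2 : 0 ≤ ε * (c p 0 * m q) := mul_nonneg hε (mul_nonneg (hc0 p) (hm0 q))
      have h3 : p + 1 + q = p + (q + 1) := by ring
      rw [h3]; linarith
  -- Each exchange of an `M` for an `M'` costs `ε * c p 0 * m q`. By Chebyshev's inequality this is
  -- at most `ε L m (p + q)`, that is, a relative loss of at most `(10/9) ε L`.
  have hcge : ∀ p q, (1 - 10 / 9 * p * (ε * L)) * m (p + q) ≤ c p q := by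
    intro p
    induction p with
    | zero => intro q; simp [hc, hm]
    | succ p ih =>
      intro q
      rw [hrec]
      have h1 := ih (q + 1)
      have h3 : p + 1 + q = p + (q + 1) := by ring
      rw [h3]
      have h4 : c p 0 * m q ≤ 10 / 9 * L * m (p + (q + 1)) := by
        have h5 : c p 0 ≤ m p := by simpa using hcle p 0
        calc c p 0 * m q ≤ m p * m q := mul_le_mul_of_nonneg_right h5 (hm0 q)
          _ ≤ (w ⬝ᵥ w) * m (p + q) := moment_mul_moment_le hMp w p q
          _ ≤ L * m (p + q) := mul_le_mul_of_nonneg_right hw (hm0 _)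
          _ ≤ L * (10 / 9 * m (p + (q + 1))) := by
            refine mul_le_mul_of_nonneg_left ?_ (hw0.trans hw)
            have := (hms (p + q)).2
            rw [← add_assoc]; linarith
          _ = _ := by ring
      have h6 := mul_le_mul_of_nonneg_left h4 hε
      push_cast
      linarith
  have htel : ∀ K : ℕ, (M ^ K).trace - (M' ^ K).trace = ε * ∑ p ∈ Finset.range K, c p (K - 1 - p) := by
    intro K
    have hK : ∀ J ≤ K, (M ^ K).trace - (M' ^ J * M ^ (K - J)).trace =
        ε * ∑ p ∈ Finset.range J, c p (K - 1 - p) := by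
      intro J
      induction J with
      | zero => simp
      | succ J ih =>
        intro hJ
        have h1 := ih (by omega)
        rw [Finset.sum_range_succ, mul_add, ← h1]
        have h2 : K - J = (K - (J + 1)) + 1 := by omega
        have h3 : K - 1 - J = K - (J + 1) := by omega
        rw [h2, h3]
        generalize K - (J + 1) = q
        have h4 : M' ^ (J + 1) * M ^ q = M' ^ J * M ^ (q + 1) - ε • (M' ^ J * vecMulVec w w * M ^ q) := by
          rw [pow_succ, pow_succ']
          nth_rewrite 2 [hM'def]
          simp only [mul_sub, sub_mul, mul_smul_comm, smul_mul_assoc, mul_assoc]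
        have hMt : Mᵀ = M := by simpa using hM.eq
        have hM't : M'ᵀ = M' := by simpa using hM'.isHermitian.eq
        have h5 : (M' ^ J * vecMulVec w w * M ^ q).trace = c J q := by
          rw [mul_assoc, trace_mul_comm, mul_assoc, vecMulVec_mul, trace_vecMulVec]
          simp only [hc]
          have : M' ^ J * M ^ q = (M ^ q * M' ^ J)ᵀ := by
            rw [transpose_mul, transpose_pow, transpose_pow, hMt, hM't]
          rw [this, mulVec_transpose]
        rw [h4, trace_sub, trace_smul, h5, smul_eq_mul]
        ring
    simpa using hK K le_rfl
  have hfin := htel N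
  have hsum : 8 / 9 * N * m N ≤ ∑ p ∈ Finset.range N, c p (N - 1 - p) := by
    have : ∀ p ∈ Finset.range N, 8 / 9 * m N ≤ c p (N - 1 - p) := by
      intro p hp
      rw [Finset.mem_range] at hp
      refine le_trans ?_ (hcge p (N - 1 - p))
      have h1 : p + (N - 1 - p) = N - 1 := by omega
      have h2 : m N ≤ m (N - 1) := by
        have := (hms (N - 1)).1
        rwa [Nat.sub_add_cancel (by omega)] at this
      rw [h1]
      have h3 : (p : ℝ) * (ε * L) ≤ N * (ε * L) :=
        mul_le_mul_of_nonneg_right (by exact_mod_cast hp.le) (mul_nonneg hε (hw0.trans hw))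
      -- At most `N` exchanges lose at most `(10/9) N ε L ≤ 1/9` in total.
      have h4 : (8 : ℝ) / 9 ≤ 1 - 10 / 9 * p * (ε * L) := by linarith
      calc 8 / 9 * m N ≤ 8 / 9 * m (N - 1) := by linarith
        _ ≤ _ := mul_le_mul_of_nonneg_right h4 (hm0 _)
    calc 8 / 9 * N * m N = ∑ _p ∈ Finset.range N, 8 / 9 * m N := by
          rw [Finset.sum_const, Finset.card_range, nsmul_eq_mul]; ring
      _ ≤ _ := Finset.sum_le_sum this
  have := mul_le_mul_of_nonneg_left hsum hε
  change _ ≤ _ - 8 / 9 * ε * N * m N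
  linarith

end Deterministic

/-! ### Lower-tail matrix Chernoff bound -/

section Chernoff

variable {ι κ : Type*}

theorem dotProduct_vecMulVec_mulVec [Fintype ι] (w v : ι → ℝ) :
    v ⬝ᵥ vecMulVec w w *ᵥ v = (w ⬝ᵥ v) ^ 2 := by
  rw [vecMulVec_mulVec, dotProduct_comm v]
  simp [sq]

theorem sq_dotProduct_le [Fintype ι] (v w : ι → ℝ) : (v ⬝ᵥ w) ^ 2 ≤ (v ⬝ᵥ v) * (w ⬝ᵥ w) := by
  have := Finset.sum_mul_sq_le_sq_mul_sq Finset.univ v w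
  simpa [dotProduct, sq] using this

theorem dotProduct_sum_vecMulVec_mulVec [Fintype ι] (H : Finset κ) (w : κ → ι → ℝ) (v : ι → ℝ) :
    v ⬝ᵥ (∑ j ∈ H, vecMulVec (w j) (w j)) *ᵥ v = ∑ j ∈ H, (w j ⬝ᵥ v) ^ 2 := by
  rw [sum_mulVec, dotProduct_sum]
  exact Finset.sum_congr rfl fun j _ => dotProduct_vecMulVec_mulVec _ _

theorem memLp_top_apply_of_dotProduct_le {Ω ι : Type*} [Fintype ι] [MeasurableSpace Ω]
    {μ : Measure Ω} {L : ℝ} {X : Ω → ι → ℝ} (hX : Measurable X)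
    (hXL : ∀ᵐ ω ∂μ, X ω ⬝ᵥ X ω ≤ L) (a : ι) : MemLp (fun ω => X ω a) ⊤ μ := by
  refine memLp_top_of_bound (by fun_prop) (√L) ?_
  filter_upwards [hXL] with ω hω
  refine Real.abs_le_sqrt (le_trans ?_ hω)
  rw [sq]
  exact Finset.single_le_sum (f := fun i => X ω i * X ω i) (fun i _ => mul_self_nonneg _)
    (Finset.mem_univ a)

variable [DecidableEq ι]

/-- The matrix `1 - ε ∑_{j ∈ H} w_j w_jᵀ`. -/
def dampedMatrix (ε : ℝ) (H : Finset κ) (w : κ → ι → ℝ) : Matrix ι ι ℝ :=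
  1 - ε • ∑ j ∈ H, vecMulVec (w j) (w j)

theorem dampedMatrix_isHermitian (ε : ℝ) (H : Finset κ) (w : κ → ι → ℝ) :
    (dampedMatrix ε H w).IsHermitian := by
  rw [dampedMatrix, IsHermitian, conjTranspose_eq_transpose_of_trivial, transpose_sub,
    transpose_one, transpose_smul, transpose_sum]
  simp [transpose_vecMulVec]

theorem dampedMatrix_insert [DecidableEq κ] (ε : ℝ) {H : Finset κ} {a : κ} (ha : a ∉ H)
    (w : κ → ι → ℝ) :
    dampedMatrix ε (insert a H) w = dampedMatrix ε H w - ε • vecMulVec (w a) (w a) := by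
  rw [dampedMatrix, dampedMatrix, Finset.sum_insert ha, smul_add]
  abel

variable [Fintype ι]

theorem dotProduct_dampedMatrix_mulVec (ε : ℝ) (H : Finset κ) (w : κ → ι → ℝ) (v : ι → ℝ) :
    v ⬝ᵥ dampedMatrix ε H w *ᵥ v = v ⬝ᵥ v - ε * ∑ j ∈ H, (w j ⬝ᵥ v) ^ 2 := by
  rw [dampedMatrix, sub_mulVec, dotProduct_sub, one_mulVec, smul_mulVec, dotProduct_smul,
    dotProduct_sum_vecMulVec_mulVec, smul_eq_mul]

theorem le_dotProduct_dampedMatrix_mulVec {ε L : ℝ} {h : ℕ} (hε : 0 ≤ ε) (hL : 0 ≤ L)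
    (hεL : h * ε * L ≤ 1 / 10) {H : Finset κ} (hH : H.card ≤ h) {w : κ → ι → ℝ}
    (hw : ∀ j ∈ H, w j ⬝ᵥ w j ≤ L) (v : ι → ℝ) :
    9 / 10 * (v ⬝ᵥ v) ≤ v ⬝ᵥ dampedMatrix ε H w *ᵥ v := by
  have hv : 0 ≤ v ⬝ᵥ v := dotProduct_self_nonneg_real v
  have h1 : ∑ j ∈ H, (w j ⬝ᵥ v) ^ 2 ≤ h * (L * (v ⬝ᵥ v)) :=
    calc ∑ j ∈ H, (w j ⬝ᵥ v) ^ 2 ≤ ∑ _j ∈ H, L * (v ⬝ᵥ v) := Finset.sum_le_sum fun j hj =>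
          (sq_dotProduct_le _ _).trans (mul_le_mul_of_nonneg_right (hw j hj) hv)
      _ = H.card * (L * (v ⬝ᵥ v)) := by rw [Finset.sum_const, nsmul_eq_mul]
      _ ≤ _ := mul_le_mul_of_nonneg_right (by exact_mod_cast hH) (mul_nonneg hL hv)
  rw [dotProduct_dampedMatrix_mulVec]
  nlinarith [mul_le_mul_of_nonneg_left h1 hε, mul_le_mul_of_nonneg_right hεL hv]

theorem dotProduct_dampedMatrix_mulVec_le {ε : ℝ} (hε : 0 ≤ ε) (H : Finset κ) (w : κ → ι → ℝ)
    (v : ι → ℝ) : v ⬝ᵥ dampedMatrix ε H w *ᵥ v ≤ v ⬝ᵥ v := by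
  rw [dotProduct_dampedMatrix_mulVec]
  have := mul_nonneg hε (Finset.sum_nonneg fun j (_ : j ∈ H) => sq_nonneg (w j ⬝ᵥ v))
  linarith

theorem dampedMatrix_posSemidef {ε L : ℝ} {h : ℕ} (hε : 0 ≤ ε) (hL : 0 ≤ L)
    (hεL : h * ε * L ≤ 1 / 10) {H : Finset κ} (hH : H.card ≤ h) {w : κ → ι → ℝ}
    (hw : ∀ j ∈ H, w j ⬝ᵥ w j ≤ L) : (dampedMatrix ε H w).PosSemidef :=
  .of_dotProduct_mulVec_nonneg (dampedMatrix_isHermitian ε H w) fun v => by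
    have h1 := le_dotProduct_dampedMatrix_mulVec hε hL hεL hH hw v
    have h2 : 0 ≤ v ⬝ᵥ v := dotProduct_self_nonneg_real v
    simp only [star_trivial]; linarith

variable {Ω : Type*} [MeasurableSpace Ω] {μ : Measure Ω} [IsProbabilityMeasure μ]
  {W : κ → Ω → ι → ℝ} {L : ℝ}

/-- The entries are polynomials in bounded coordinates; this supplies integrability for the
expectations of the potential. -/
theorem memLp_top_dampedMatrix_pow (hW : ∀ j, Measurable (W j))
    (hWL : ∀ j, ∀ᵐ ω ∂μ, W j ω ⬝ᵥ W j ω ≤ L) (ε : ℝ) (H : Finset κ) (N : ℕ) (a b : ι) :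
    MemLp (fun ω => (dampedMatrix ε H (fun j => W j ω) ^ N) a b) ⊤ μ := by
  have hmul : ∀ {f g : Ω → ℝ}, MemLp f ⊤ μ → MemLp g ⊤ μ → MemLp (fun ω => f ω * g ω) ⊤ μ :=
    fun hf hg => hg.mul hf
  induction N generalizing a b with
  | zero => simpa using memLp_const _
  | succ N ih =>
    simp only [pow_succ, mul_apply]
    refine memLp_finsetSum _ fun i _ => hmul (ih a i) ?_
    simp only [dampedMatrix, Matrix.sub_apply, Matrix.smul_apply, Matrix.sum_apply,
      vecMulVec_apply, smul_eq_mul]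
    have hww : ∀ j, MemLp (fun ω => W j ω i * W j ω b) ⊤ μ := fun j =>
      hmul (memLp_top_apply_of_dotProduct_le (hW j) (hWL j) i)
        (memLp_top_apply_of_dotProduct_le (hW j) (hWL j) b)
    have hsum : MemLp (fun ω => ∑ j ∈ H, W j ω i * W j ω b) ⊤ μ :=
      memLp_finsetSum H fun j _ => hww j
    have hε : MemLp (fun ω => ε * ∑ j ∈ H, W j ω i * W j ω b) ⊤ μ := hsum.const_mul ε
    have hone : MemLp (fun _ : Ω => (1 : Matrix ι ι ℝ) i b) ⊤ μ := memLp_const _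
    exact hone.sub hε

/-- A rank-one quadratic form in a sample point integrates to the trace, by independence. -/
theorem integral_dotProduct_dampedMatrix_pow (hW : ∀ j, Measurable (W j)) (hind : iIndepFun W μ)
    (hWL : ∀ j, ∀ᵐ ω ∂μ, W j ω ⬝ᵥ W j ω ≤ L)
    (hcov : ∀ j a b, ∫ ω, W j ω a * W j ω b ∂μ = (1 : Matrix ι ι ℝ) a b)
    (ε : ℝ) {H : Finset κ} {i : κ} (hi : i ∉ H) (N : ℕ) :
    Integrable (fun ω => W i ω ⬝ᵥ (dampedMatrix ε H (fun j => W j ω) ^ N) *ᵥ W i ω) μ ∧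
    ∫ ω, W i ω ⬝ᵥ (dampedMatrix ε H (fun j => W j ω) ^ N) *ᵥ W i ω ∂μ =
      ∫ ω, (dampedMatrix ε H (fun j => W j ω) ^ N).trace ∂μ := by
  have hmul : ∀ {f g : Ω → ℝ}, MemLp f ⊤ μ → MemLp g ⊤ μ → MemLp (fun ω => f ω * g ω) ⊤ μ :=
    fun hf hg => hg.mul hf
  have hD := memLp_top_dampedMatrix_pow hW hWL ε H N
  have hw := fun a => memLp_top_apply_of_dotProduct_le (hW i) (hWL i) a
  have hexp : ∀ ω, W i ω ⬝ᵥ (dampedMatrix ε H (fun j => W j ω) ^ N) *ᵥ W i ω =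
      ∑ a, ∑ b, (W i ω a * W i ω b) * (dampedMatrix ε H (fun j => W j ω) ^ N) a b := by
    intro ω
    simp only [dotProduct, mulVec, Finset.mul_sum]
    exact Finset.sum_congr rfl fun a _ => Finset.sum_congr rfl fun b _ => by ring
  have hint : ∀ a b, Integrable
      (fun ω => (W i ω a * W i ω b) * (dampedMatrix ε H (fun j => W j ω) ^ N) a b) μ := fun a b =>
    (hmul (hmul (hw a) (hw b)) (hD a b)).integrable le_top
  simp only [hexp]
  refine ⟨integrable_finsetSum _ fun a _ => integrable_finsetSum _ fun b _ => hint a b, ?_⟩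
  rw [integral_finsetSum _ fun a _ => integrable_finsetSum _ fun b _ => hint a b]
  simp only [trace, diag_apply]
  rw [integral_finsetSum _ fun a _ => (hD a a).integrable le_top]
  refine Finset.sum_congr rfl fun a _ => ?_
  rw [integral_finsetSum _ fun b _ => hint a b]
  have hprod : ∀ b, ∫ ω, (W i ω a * W i ω b) * (dampedMatrix ε H (fun j => W j ω) ^ N) a b ∂μ =
      (1 : Matrix ι ι ℝ) a b * ∫ ω, (dampedMatrix ε H (fun j => W j ω) ^ N) a b ∂μ := by
    intro b
    have hI := hind.indepFun_finset {i} H (by simpa using hi) hW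
    let φ : (({i} : Finset κ) → ι → ℝ) → ℝ := fun x =>
      x ⟨i, Finset.mem_singleton_self i⟩ a * x ⟨i, Finset.mem_singleton_self i⟩ b
    -- Indexing by the subtype `H` exhibits the matrix as a function of the points in `H` alone,
    -- hence independent of `W i`.
    let ψ : (H → ι → ℝ) → ℝ := fun x => (dampedMatrix ε Finset.univ x ^ N) a b
    have hφ : Measurable φ := by fun_prop
    have hψ : Measurable ψ := by
      have hc : Continuous fun x : H → ι → ℝ => dampedMatrix ε Finset.univ x ^ N := by
        refine Continuous.pow ?_ N
        unfold dampedMatrix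
        refine continuous_const.sub (Continuous.fun_const_smul ?_ ε)
        exact continuous_finsetSum _ fun j _ =>
          Continuous.matrix_vecMulVec (continuous_apply j) (continuous_apply j)
      exact (hc.matrix_elem a b).measurable
    have hI2 := hI.comp hφ hψ
    have hψe : (ψ ∘ fun ω (j : H) => W j ω) =
        fun ω => (dampedMatrix ε H (fun j => W j ω) ^ N) a b := by
      funext ω
      simp only [ψ, Function.comp, dampedMatrix]
      rw [← Finset.sum_coe_sort H fun j => vecMulVec (W j ω) (W j ω)]
    rw [hψe] at hI2
    have := hI2.integral_fun_mul_eq_mul_integral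
      (((hw a).aestronglyMeasurable.mul (hw b).aestronglyMeasurable)) (hD a b).aestronglyMeasurable
    rw [← hcov i a b]
    exact this
  simp only [hprod]
  simp [one_apply]

/-- Induction on the points of `H` with the exponent `h` held fixed: the one-step decrease is
averaged over the new point, independent of the others, and yields one factor `1 - 8/9 * ε * h`. -/
theorem integral_trace_dampedMatrix_pow_le (hW : ∀ j, Measurable (W j)) (hind : iIndepFun W μ)
    (hWL : ∀ j, ∀ᵐ ω ∂μ, W j ω ⬝ᵥ W j ω ≤ L)
    (hcov : ∀ j a b, ∫ ω, W j ω a * W j ω b ∂μ = (1 : Matrix ι ι ℝ) a b)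
    {ε : ℝ} {h : ℕ} (hε : 0 ≤ ε) (hL : 1 ≤ L) (hεL : h * ε * L ≤ 1 / 10)
    (H : Finset κ) (hH : H.card ≤ h) :
    ∫ ω, (dampedMatrix ε H (fun j => W j ω) ^ h).trace ∂μ ≤
      Fintype.card ι * (1 - 8 / 9 * ε * h) ^ H.card := by
  classical
  have htr : ∀ (H : Finset κ), Integrable
      (fun ω => (dampedMatrix ε H (fun j => W j ω) ^ h).trace) μ := fun H =>
    integrable_finsetSum _ fun a _ => (memLp_top_dampedMatrix_pow hW hWL ε H h a a).integrable le_top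
  have hρ : 0 ≤ 1 - 8 / 9 * ε * h := by
    have : (h * ε) * 1 ≤ h * ε * L := mul_le_mul_of_nonneg_left hL (by positivity)
    linarith
  induction H using Finset.induction_on with
  | empty => simp [dampedMatrix]
  | insert i H hi ih =>
    have hcard : H.card + 1 ≤ h := by rwa [Finset.card_insert_of_notMem hi] at hH
    obtain ⟨hq, hq2⟩ := integral_dotProduct_dampedMatrix_pow hW hind hWL hcov ε hi h
    have hall : ∀ᵐ ω ∂μ, ∀ j ∈ insert i H, W j ω ⬝ᵥ W j ω ≤ L :=
      (Finset.eventually_all _).2 fun j _ => hWL j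
    calc ∫ ω, (dampedMatrix ε (insert i H) (fun j => W j ω) ^ h).trace ∂μ
        ≤ ∫ ω, ((dampedMatrix ε H (fun j => W j ω) ^ h).trace - 8 / 9 * ε * h *
            (W i ω ⬝ᵥ (dampedMatrix ε H (fun j => W j ω) ^ h) *ᵥ W i ω)) ∂μ := by
          refine integral_mono_ae (htr _) ((htr _).sub (hq.const_mul _)) ?_
          filter_upwards [hall] with ω hω
          have hP := dampedMatrix_posSemidef hε (by linarith) hεL hH hω
          have hω' : ∀ j ∈ H, W j ω ⬝ᵥ W j ω ≤ L := fun j hj => hω j (Finset.mem_insert_of_mem hj)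
          rw [dampedMatrix_insert ε hi] at hP ⊢
          exact trace_pow_sub_vecMulVec_le (dampedMatrix_isHermitian _ _ _)
            (le_dotProduct_dampedMatrix_mulVec hε (by linarith) hεL (by omega) hω')
            (dotProduct_dampedMatrix_mulVec_le hε _ _) hP hε (hω i (Finset.mem_insert_self i H)) hεL
      _ = (1 - 8 / 9 * ε * h) * ∫ ω, (dampedMatrix ε H (fun j => W j ω) ^ h).trace ∂μ := by
          rw [integral_sub (htr _) (hq.const_mul _), integral_const_mul, hq2]
          ring
      _ ≤ (1 - 8 / 9 * ε * h) * (Fintype.card ι * (1 - 8 / 9 * ε * h) ^ H.card) :=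
          mul_le_mul_of_nonneg_left (ih (by omega)) hρ
      _ = _ := by rw [Finset.card_insert_of_notMem hi, pow_succ]; ring

/-- Lower-tail matrix Chernoff bound for rank-one summands with identity second moment. -/
theorem measure_exists_sum_lt_le (hW : ∀ j, Measurable (W j)) (hind : iIndepFun W μ)
    (hWL : ∀ j, ∀ᵐ ω ∂μ, W j ω ⬝ᵥ W j ω ≤ L)
    (hcov : ∀ j a b, ∫ ω, W j ω a * W j ω b ∂μ = (1 : Matrix ι ι ℝ) a b) (H : Finset κ) :
    μ {ω | ∃ v : ι → ℝ, ∑ j ∈ H, (W j ω ⬝ᵥ v) ^ 2 < 2 / 3 * H.card * (v ⬝ᵥ v)} ≤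
      ENNReal.ofReal (Fintype.card ι * Real.exp (-(H.card / (60 * L)))) := by
  rcases H.eq_empty_or_nonempty with rfl | ⟨j₀, hj₀⟩
  · simp
  rcases isEmpty_or_nonempty ι with hι | ⟨⟨a₀⟩⟩
  · simp
  have hL : 1 ≤ L := by
    have h1 : ∫ ω, W j₀ ω a₀ * W j₀ ω a₀ ∂μ = 1 := by simpa using hcov j₀ a₀ a₀
    rw [← h1]
    have hm := memLp_top_apply_of_dotProduct_le (hW j₀) (hWL j₀) a₀
    calc ∫ ω, W j₀ ω a₀ * W j₀ ω a₀ ∂μ ≤ ∫ _ω, L ∂μ := by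
          refine integral_mono_ae ((MemLp.mul (r := ⊤) hm hm).integrable le_top)
            (integrable_const _) ?_
          filter_upwards [hWL j₀] with ω hω
          exact (Finset.single_le_sum (f := fun i => W j₀ ω i * W j₀ ω i)
            (fun i _ => mul_self_nonneg _) (Finset.mem_univ a₀)).trans hω
      _ = L := by simp
  set h := H.card with hh
  have hpos : 0 < h := Finset.card_pos.2 ⟨j₀, hj₀⟩
  have hpos' : (0 : ℝ) < h := by exact_mod_cast hpos
  -- The largest step size allowed by the one-step estimate with exponent `h`.
  set ε : ℝ := 1 / (10 * h * L) with hεdef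
  have hε : 0 ≤ ε := by positivity
  have hεL : h * ε * L = 1 / 10 := by rw [hεdef]; field_simp
  have hint : Integrable (fun ω => (dampedMatrix ε H (fun j => W j ω) ^ h).trace) μ :=
    integrable_finsetSum _ fun a _ => (memLp_top_dampedMatrix_pow hW hWL ε H h a a).integrable le_top
  have hE := integral_trace_dampedMatrix_pow_le hW hind hWL hcov hε hL hεL.le H hh.ge
  have hall : ∀ᵐ ω ∂μ, ∀ j ∈ H, W j ω ⬝ᵥ W j ω ≤ L := (Finset.eventually_all _).2 fun j _ => hWL j
  have hpsd : ∀ᵐ ω ∂μ, (dampedMatrix ε H (fun j => W j ω)).PosSemidef := by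
    filter_upwards [hall] with ω hω
    exact dampedMatrix_posSemidef hε (by linarith) hεL.le hh.ge hω
  have hnn : 0 ≤ᵐ[μ] fun ω => (dampedMatrix ε H (fun j => W j ω) ^ h).trace := by
    filter_upwards [hpsd] with ω hω
    exact (hω.pow h).trace_nonneg
  set y : ℝ := 1 / L with hy
  have hy0 : 0 < y := by positivity
  have hy1 : y ≤ 1 := by rw [hy, div_le_one (by linarith)]; exact hL
  -- A direction with sum below `(2/3) h |v|²` gives `M` a Rayleigh quotient above `1 - (2/3) ε h`,
  -- and `ε h = y / 10`.
  set a : ℝ := 1 - y / 15 with ha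
  have ha0 : 0 < a := by linarith
  have hεh : ε * h = y / 10 := by rw [hεdef, hy]; field_simp
  have hmk := mul_meas_ge_le_integral_of_nonneg hnn hint (a ^ h)
  have hsub : μ {ω | ∃ v : ι → ℝ, ∑ j ∈ H, (W j ω ⬝ᵥ v) ^ 2 < 2 / 3 * h * (v ⬝ᵥ v)} ≤
      μ {ω | a ^ h ≤ (dampedMatrix ε H (fun j => W j ω) ^ h).trace} := by
    refine measure_mono_ae ?_
    filter_upwards [hpsd] with ω hω
    rintro ⟨v, hv⟩
    refine pow_le_trace_pow hω ha0.le v ?_ h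
    rw [dotProduct_dampedMatrix_mulVec]
    have hε' : 0 < ε := by positivity
    have h1 := mul_lt_mul_of_pos_left hv hε'
    have h2 : ε * (2 / 3 * h * (v ⬝ᵥ v)) = y / 15 * (v ⬝ᵥ v) := by
      rw [show ε * (2 / 3 * h * (v ⬝ᵥ v)) = 2 / 3 * (ε * h) * (v ⬝ᵥ v) by ring, hεh]; ring
    rw [ha]; linarith
  refine hsub.trans ?_
  rw [← ofReal_measureReal]
  refine ENNReal.ofReal_le_ofReal ?_
  -- For `0 ≤ y ≤ 1` one has `(1 + y/14)(1 - y/15) ≥ 1`.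
  have hexp_a : Real.exp (-(y / 14)) ≤ a := by
    rw [Real.exp_neg, inv_le_comm₀ (Real.exp_pos _) ha0]
    refine le_trans ?_ (Real.add_one_le_exp (y / 14))
    rw [inv_le_iff_one_le_mul₀ ha0, ha]
    nlinarith
  have hρ : 1 - 8 / 9 * ε * h ≤ Real.exp (-(4 * y / 45)) := by
    have := Real.add_one_le_exp (-(4 * y / 45))
    have h3 : 8 / 9 * ε * h = 4 * y / 45 := by rw [mul_assoc, hεh]; ring
    linarith
  have hρ0 : 0 ≤ 1 - 8 / 9 * ε * h := by
    rw [mul_assoc, hεh]; linarith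
  have hfin : Real.exp (-(y / 14)) ^ h *
      μ.real {ω | a ^ h ≤ (dampedMatrix ε H (fun j => W j ω) ^ h).trace} ≤
      Fintype.card ι * Real.exp (-(4 * y / 45)) ^ h := by
    calc _ ≤ a ^ h * μ.real {ω | a ^ h ≤ (dampedMatrix ε H (fun j => W j ω) ^ h).trace} :=
          mul_le_mul_of_nonneg_right (pow_le_pow_left₀ (Real.exp_pos _).le hexp_a h)
            measureReal_nonneg
      _ ≤ _ := hmk
      _ ≤ _ := hE
      _ ≤ _ := mul_le_mul_of_nonneg_left (pow_le_pow_left₀ hρ0 hρ h) (Nat.cast_nonneg _)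
  rw [← Real.exp_nat_mul, ← Real.exp_nat_mul] at hfin
  rw [mul_comm, ← le_div_iff₀ (Real.exp_pos _), mul_div_assoc, ← Real.exp_sub] at hfin
  refine hfin.trans (mul_le_mul_of_nonneg_left (Real.exp_le_exp.2 ?_) (Nat.cast_nonneg _))
  -- The net exponent is `4/45 - 1/14 = 11/630`, which exceeds `1/60`.
  have h4 : h / (60 * L) = h * y / 60 := by rw [hy]; field_simp
  rw [h4]
  have := mul_pos hpos' hy0
  linarith

end Chernoff

/-! ### Whitening and comparison of pseudoinverses -/

variable {d : ℕ}

theorem cfc_apply_eq_sum {A : Matrix (Fin d) (Fin d) ℝ} (hA : A.IsHermitian) (f : ℝ → ℝ)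
    (i j : Fin d) :
    cfc f A i j = ∑ l, (hA.eigenvectorUnitary : Matrix (Fin d) (Fin d) ℝ) i l *
      f (hA.eigenvalues l) * (hA.eigenvectorUnitary : Matrix (Fin d) (Fin d) ℝ) j l := by
  rw [hA.cfc_eq, IsHermitian.cfc, Unitary.conjStarAlgAut_apply, mul_apply]
  simp [mul_diagonal]

/-- A positive semidefinite matrix `A` factors through coordinates on its range in which it is
the identity. -/
theorem exists_whitening {A : Matrix (Fin d) (Fin d) ℝ} (hA : A.PosSemidef) :
    ∃ (ι : Type) (_ : Fintype ι) (_ : DecidableEq ι) (S T : Matrix ι (Fin d) ℝ),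
      Fintype.card ι ≤ d ∧ Sᵀ * S = pinv A ∧ Tᵀ * T = A ∧ T * Sᵀ = 1 := by
  classical
  have hH := hA.isHermitian
  set lam := hH.eigenvalues with hlam
  have hlam0 : ∀ i, 0 ≤ lam i := hA.eigenvalues_nonneg
  set U : Matrix (Fin d) (Fin d) ℝ := (hH.eigenvectorUnitary : Matrix (Fin d) (Fin d) ℝ) with hU
  have hUU : Uᵀ * U = 1 := by
    have : star U * U = 1 := by simp [hU]
    simpa [star_eq_conjTranspose] using this
  have hsub : ∀ f : Fin d → ℝ, (∀ l, lam l = 0 → f l = 0) →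
      ∑ l : {i : Fin d // lam i ≠ 0}, f l = ∑ l, f l := by
    intro f hf
    rw [← Finset.sum_subtype (Finset.univ.filter fun l => lam l ≠ 0) (by simp) f]
    exact Finset.sum_filter_of_ne fun l _ h hl => h (hf l hl)
  -- With only the nonzero eigenvalues kept, `S = Λ^{-1/2} Uᵀ` and `T = Λ^{1/2} Uᵀ`.
  refine ⟨{i : Fin d // lam i ≠ 0}, inferInstance, inferInstance,
    of fun i j => (√(lam i))⁻¹ * U j i, of fun i j => √(lam i) * U j i, ?_, ?_, ?_, ?_⟩
  · exact (Fintype.card_subtype_le _).trans (by simp)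
  · ext i j
    rw [pinv, cfc_apply_eq_sum hH, mul_apply]
    simp only [transpose_apply, of_apply]
    rw [hsub (fun l => (√(lam l))⁻¹ * U i l * ((√(lam l))⁻¹ * U j l)) fun l hl => by simp [hl]]
    refine Finset.sum_congr rfl fun l _ => ?_
    have : (lam l)⁻¹ = (√(lam l))⁻¹ * (√(lam l))⁻¹ := by
      rw [← mul_inv, Real.mul_self_sqrt (hlam0 l)]
    rw [this]
    ring
  · ext i j
    have hid : A i j = ∑ l, U i l * lam l * U j l := by
      exact (congrFun (congrFun (cfc_id' ℝ A hH).symm i) j).trans (cfc_apply_eq_sum hH _ i j)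
    rw [hid, mul_apply]
    simp only [transpose_apply, of_apply]
    rw [hsub (fun l => √(lam l) * U i l * (√(lam l) * U j l)) fun l hl => by simp [hl]]
    refine Finset.sum_congr rfl fun l _ => ?_
    nth_rewrite 3 [← Real.mul_self_sqrt (hlam0 l)]
    ring
  · ext i j
    have h1 := congrFun (congrFun hUU i) j
    rw [mul_apply] at h1 ⊢
    simp only [transpose_apply, of_apply] at h1 ⊢
    have h2 : √(lam i) ≠ 0 := fun h => i.2 (by rw [← Real.mul_self_sqrt (hlam0 i), h, zero_mul])
    calc ∑ l, √(lam i) * U l i * ((√(lam j))⁻¹ * U l j)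
        = √(lam i) * (√(lam j))⁻¹ * ∑ l, U l i * U l j := by
          rw [Finset.mul_sum]; exact Finset.sum_congr rfl fun l _ => by ring
      _ = _ := by
          rw [h1]
          by_cases hij : i = j
          · subst hij; simp [h2]
          · have : (i : Fin d) ≠ j := fun h => hij (Subtype.ext h)
            simp [one_apply, hij, this]

theorem dotProduct_gram_mulVec {ι : Type*} [Fintype ι] {B : Matrix (Fin d) (Fin d) ℝ}
    {T : Matrix ι (Fin d) ℝ} (hT : Tᵀ * T = B) (z : Fin d → ℝ) :
    z ⬝ᵥ B *ᵥ z = (T *ᵥ z) ⬝ᵥ (T *ᵥ z) := by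
  rw [← hT, ← mulVec_mulVec, dotProduct_mulVec, vecMul_transpose]

/-- Comparison of the quadratic forms of two pseudoinverses on the range of the larger matrix. -/
theorem dotProduct_pinv_mulVec_le {ι : Type*} [Fintype ι] {A B : Matrix (Fin d) (Fin d) ℝ}
    (hA : A.IsHermitian) {S T : Matrix ι (Fin d) ℝ} (hS : Sᵀ * S = pinv B) (hT : Tᵀ * T = B)
    {κ : ℝ} (hκ : 0 ≤ κ) (hAB : ∀ v, v ⬝ᵥ B *ᵥ v ≤ κ * (v ⬝ᵥ A *ᵥ v)) {z : Fin d → ℝ}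
    (hz : Tᵀ *ᵥ (S *ᵥ z) = z) :
    z ⬝ᵥ pinv A *ᵥ z ≤ κ * (z ⬝ᵥ pinv B *ᵥ z) := by
  obtain ⟨-, h2, -, -⟩ := pinv_penrose A hA
  have hPsymm : (pinv A)ᵀ = pinv A := by
    have : (pinv A).IsHermitian := cfc_predicate (R := ℝ) (fun x : ℝ => x⁻¹) A
    simpa using this.eq
  set w := pinv A *ᵥ z with hw
  have hwA : w ⬝ᵥ A *ᵥ w = z ⬝ᵥ w := by
    have h3 : z ⬝ᵥ w = z ⬝ᵥ pinv A *ᵥ A *ᵥ w := by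
      rw [hw, mulVec_mulVec, mulVec_mulVec, h2]
    rw [h3, dotProduct_mulVec z, ← mulVec_transpose, hPsymm]
  have hSz : z ⬝ᵥ pinv B *ᵥ z = (S *ᵥ z) ⬝ᵥ (S *ᵥ z) :=
    dotProduct_gram_mulVec hS _
  have hTw : w ⬝ᵥ B *ᵥ w = (T *ᵥ w) ⬝ᵥ (T *ᵥ w) :=
    dotProduct_gram_mulVec hT _
  have hq : z ⬝ᵥ w = (T *ᵥ w) ⬝ᵥ (S *ᵥ z) := by
    conv_lhs => rw [← hz]
    rw [mulVec_transpose, ← dotProduct_mulVec, dotProduct_comm]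
  -- With `q = z ⬝ᵥ w = wᵀ A w`, Cauchy–Schwarz and `hAB` give `q² ≤ κ q (zᵀ B† z)`; cancelling `q >
  -- 0` proves the claim.
  have hcs' : (z ⬝ᵥ w) ^ 2 ≤ (w ⬝ᵥ B *ᵥ w) * (z ⬝ᵥ pinv B *ᵥ z) := by
    rw [hq, hTw, hSz]; exact sq_dotProduct_le _ _
  have hs : 0 ≤ z ⬝ᵥ pinv B *ᵥ z := by
    rw [hSz]; exact dotProduct_self_nonneg_real _
  have h4 := hAB w
  rw [hwA] at h4
  by_contra! hcon
  have h5 : 0 < z ⬝ᵥ w := lt_of_le_of_lt (mul_nonneg hκ hs) hcon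
  nlinarith [mul_le_mul_of_nonneg_right h4 hs]

/-! ### Second moments of a law and their range -/

section SecondMoment

variable {P : Measure (Fin d → ℝ)}

theorem memLp_dotProduct {p : ENNReal} (hP : MemLp (fun z : Fin d → ℝ => z) p P) (v : Fin d → ℝ) :
    MemLp (fun z => v ⬝ᵥ z) p P := by
  simp only [dotProduct]
  exact memLp_finsetSum _ fun i _ => MemLp.const_mul (hP.eval i) (v i)

theorem integrable_dotProduct_sq (hP : MemLp (fun z : Fin d → ℝ => z) 2 P) (v : Fin d → ℝ) :
    Integrable (fun z => (v ⬝ᵥ z) ^ 2) P :=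
  (memLp_dotProduct hP v).integrable_sq

theorem dotProduct_secondMoment_mulVec (hP : MemLp (fun z : Fin d → ℝ => z) 2 P)
    (v w : Fin d → ℝ) :
    v ⬝ᵥ secondMoment P *ᵥ w = ∫ z, (v ⬝ᵥ z) * (w ⬝ᵥ z) ∂P := by
  have hint : ∀ i j, Integrable (fun z : Fin d → ℝ => v i * w j * (z i * z j)) P := fun i j =>
    ((hP.eval i).integrable_mul (hP.eval j)).const_mul _
  have hexp : ∀ z : Fin d → ℝ, (v ⬝ᵥ z) * (w ⬝ᵥ z) = ∑ i, ∑ j, v i * w j * (z i * z j) := by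
    intro z
    simp only [dotProduct, Finset.sum_mul_sum]
    exact Finset.sum_congr rfl fun i _ => Finset.sum_congr rfl fun j _ => by ring
  simp only [hexp]
  rw [integral_finsetSum _ fun i _ => integrable_finsetSum _ fun j _ => hint i j]
  simp only [dotProduct, mulVec, secondMoment, of_apply, Finset.mul_sum]
  refine Finset.sum_congr rfl fun i _ => ?_
  rw [integral_finsetSum _ fun j _ => hint i j]
  refine Finset.sum_congr rfl fun j _ => ?_
  rw [integral_const_mul]
  ring

theorem dotProduct_secondMoment_mulVec_self (hP : MemLp (fun z : Fin d → ℝ => z) 2 P)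
    (v : Fin d → ℝ) : v ⬝ᵥ secondMoment P *ᵥ v = ∫ z, (v ⬝ᵥ z) ^ 2 ∂P := by
  rw [dotProduct_secondMoment_mulVec hP]
  simp only [sq]

theorem secondMoment_isHermitian (P : Measure (Fin d → ℝ)) : (secondMoment P).IsHermitian := by
  ext i j
  simp [secondMoment, mul_comm]

theorem secondMoment_posSemidef (hP : MemLp (fun z : Fin d → ℝ => z) 2 P) :
    (secondMoment P).PosSemidef :=
  .of_dotProduct_mulVec_nonneg (secondMoment_isHermitian P) fun v => by
    rw [star_trivial, dotProduct_secondMoment_mulVec_self hP]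
    exact integral_nonneg fun z => sq_nonneg _

/-- Almost every vector lies in the range of the second-moment matrix. -/
theorem ae_transpose_mulVec_mulVec_eq {ι : Type*} [Fintype ι] [DecidableEq ι]
    (hP : MemLp (fun z : Fin d → ℝ => z) 2 P)
    {S T : Matrix ι (Fin d) ℝ} (hT : Tᵀ * T = secondMoment P) (hTS : T * Sᵀ = 1) :
    ∀ᵐ z ∂P, Tᵀ *ᵥ (S *ᵥ z) = z := by
  have hcol : ∀ j : Fin d, ∀ᵐ z ∂P, (Tᵀ *ᵥ (S *ᵥ z)) j = z j := by
    intro j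
    -- This is the projection of the `j`-th basis vector onto the kernel of the second moment, so `u
    -- ⬝ᵥ z` has zero variance about `0` and vanishes almost everywhere.
    set u : Fin d → ℝ := Pi.single j 1 - Sᵀ *ᵥ T *ᵥ Pi.single j 1 with hu
    have hTu : T *ᵥ u = 0 := by
      rw [hu, mulVec_sub, mulVec_mulVec _ T, hTS, one_mulVec, sub_self]
    have h0 : ∫ z, (u ⬝ᵥ z) ^ 2 ∂P = 0 := by
      rw [← dotProduct_secondMoment_mulVec_self hP, ← hT, ← mulVec_mulVec, hTu]
      simp
    rw [integral_eq_zero_iff_of_nonneg (fun z => sq_nonneg _) (integrable_dotProduct_sq hP u)] at h0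
    filter_upwards [h0] with z hz
    have hz0 : u ⬝ᵥ z = 0 := by simpa using hz
    rw [hu, sub_dotProduct, mulVec_transpose, ← dotProduct_mulVec, ← vecMul_transpose,
      ← dotProduct_mulVec, single_one_dotProduct, single_one_dotProduct] at hz0
    linarith
  filter_upwards [ae_all_iff.2 hcol] with z hz
  exact funext hz

end SecondMoment

/-! ### Norm-boundedness of a bounded sample -/

theorem whitening_mul_mul {ι : Type*} [Fintype ι] [DecidableEq ι] {B : Matrix (Fin d) (Fin d) ℝ}
    {S T : Matrix ι (Fin d) ℝ} (hT : Tᵀ * T = B) (hTS : T * Sᵀ = 1) (a b : ι) :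
    S a ⬝ᵥ B *ᵥ S b = (1 : Matrix ι ι ℝ) a b := by
  have h : S * B * Sᵀ = 1 := by
    calc S * B * Sᵀ = (T * Sᵀ)ᵀ * (T * Sᵀ) := by
          rw [← hT, transpose_mul, transpose_transpose]; simp only [Matrix.mul_assoc]
      _ = 1 := by rw [hTS]; simp
  rw [← h, Matrix.mul_assoc]
  rfl

theorem dotProduct_scov_mulVec {n : ℕ} (z : Fin n → Fin d → ℝ) (H : Finset (Fin n))
    (v : Fin d → ℝ) : v ⬝ᵥ scov z H *ᵥ v = 1 / (n : ℝ) * ∑ j ∈ H, (z j ⬝ᵥ v) ^ 2 := by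
  rw [scov, smul_mulVec, dotProduct_smul, dotProduct_sum_vecMulVec_mulVec, smul_eq_mul]

theorem scov_isHermitian {n : ℕ} (z : Fin n → Fin d → ℝ) (H : Finset (Fin n)) :
    (scov z H).IsHermitian := by
  rw [scov, IsHermitian, conjTranspose_eq_transpose_of_trivial, transpose_smul, transpose_sum]
  simp [transpose_vecMulVec]

theorem card_firstHalf_secondHalf (h : ℕ) :
    (firstHalf (h + h)).card = h ∧ (secondHalf (h + h)).card = h := by
  have h1 : (firstHalf (h + h)).card = h := by
    rw [firstHalf, Fin.card_filter_val_lt]; omega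
  refine ⟨h1, ?_⟩
  have h2 := Finset.card_filter_add_card_filter_not (s := (Finset.univ : Finset (Fin (h + h))))
    (fun i => (i : ℕ) < (h + h) / 2)
  have h3 : secondHalf (h + h) =
      Finset.univ.filter fun i : Fin (h + h) => ¬ (i : ℕ) < (h + h) / 2 := by
    simp [secondHalf]
  rw [h3]
  rw [firstHalf] at h1
  simp only [Finset.card_univ, Fintype.card_fin] at h2
  omega

theorem card_mul_exp_le {r n : ℕ} {b δ : ℝ} (hr : r ≤ d) (hd : 0 < d) (hδ : 0 < δ)
    (hb : 0 < b ^ 2) (hn : 180 * b ^ 2 * Real.log (2 * (d : ℝ) / δ) ≤ n) :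
    r * Real.exp (-(n / (180 * b ^ 2))) ≤ δ := by
  have hd' : (0 : ℝ) < d := by exact_mod_cast hd
  have h1 : Real.log (2 * d / δ) ≤ n / (180 * b ^ 2) := by
    rw [le_div_iff₀ (by positivity)]; linarith
  calc r * Real.exp (-(n / (180 * b ^ 2))) ≤ d * Real.exp (-Real.log (2 * d / δ)) := by
        refine mul_le_mul (by exact_mod_cast hr) (Real.exp_le_exp.2 (by linarith))
          (Real.exp_pos _).le hd'.le
    _ = δ / 2 := by
        rw [Real.exp_neg, Real.exp_log (by positivity)]; field_simp
    _ ≤ δ := by linarith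

/-- Norm-boundedness of a sample whose law is bounded in the norm of its own second moment. -/
theorem measure_not_normBounded_le {n : ℕ} {δ b : ℝ} (hd : 0 < d) (hn : Even n) (hδ : 0 < δ)
    (hC : 180 * b ^ 2 * Real.log (2 * (d : ℝ) / δ) ≤ n)
    {Ω : Type*} [MeasurableSpace Ω] (μ : Measure Ω) [IsProbabilityMeasure μ]
    (P : Measure (Fin d → ℝ)) {Z : Fin n → Ω → Fin d → ℝ}
    (hP : MemLp (fun z : Fin d → ℝ => z) 2 P)
    (hPb : ∀ᵐ z ∂P, z ⬝ᵥ pinv (secondMoment P) *ᵥ z ≤ 3 / 2 * b ^ 2)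
    (hZ : IsIIDSample Z P μ) :
    μ {ω | ¬ NormBounded (fun i => Z i ω) (3 / √2 * b)} ≤ ENNReal.ofReal (2 * δ) := by
  obtain ⟨hmeas, hmap, hind⟩ := hZ
  rcases Nat.eq_zero_or_pos n with rfl | hnpos
  · simp [NormBounded]
  have hnpos' : (0 : ℝ) < n := by exact_mod_cast hnpos
  obtain ⟨ι, _, _, S, T, hcard, hS, hT, hTS⟩ := exists_whitening (secondMoment_posSemidef hP)
  have hlaw : ∀ {p : (Fin d → ℝ) → Prop}, (∀ᵐ z ∂P, p z) → ∀ i, ∀ᵐ ω ∂μ, p (Z i ω) := by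
    intro p hp i
    rw [← hmap i] at hp
    exact ae_of_ae_map (hmeas i).aemeasurable hp
  have hWm : Measurable fun z : Fin d → ℝ => S *ᵥ z :=
    (Continuous.matrix_mulVec continuous_const continuous_id).measurable
  set W : Fin n → Ω → ι → ℝ := fun i ω => S *ᵥ Z i ω with hWdef
  have hW : ∀ j, Measurable (W j) := fun j => hWm.comp (hmeas j)
  have hWind : iIndepFun W μ := hind.comp _ fun _ => hWm
  have hWL : ∀ j, ∀ᵐ ω ∂μ, W j ω ⬝ᵥ W j ω ≤ 3 / 2 * b ^ 2 := by
    intro j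
    filter_upwards [hlaw hPb j] with ω hω
    rwa [dotProduct_gram_mulVec hS] at hω
  have hcov : ∀ j a c, ∫ ω, W j ω a * W j ω c ∂μ = (1 : Matrix ι ι ℝ) a c := by
    intro j a c
    rw [← whitening_mul_mul hT hTS a c, dotProduct_secondMoment_mulVec hP, ← hmap j,
      integral_map (hmeas j).aemeasurable]
    · rfl
    · exact Measurable.aestronglyMeasurable
        (((measurable_pi_apply a).comp hWm).mul ((measurable_pi_apply c).comp hWm))
  have hbad : ∀ H : Finset (Fin n), (H.card : ℝ) = n / 2 →
      μ {ω | ∃ v : ι → ℝ, ∑ j ∈ H, (W j ω ⬝ᵥ v) ^ 2 < 2 / 3 * H.card * (v ⬝ᵥ v)} ≤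
        ENNReal.ofReal δ := by
    intro H hH
    refine (measure_exists_sum_lt_le hW hWind hWL hcov H).trans (ENNReal.ofReal_le_ofReal ?_)
    rcases isEmpty_or_nonempty ι with hι | ⟨⟨a⟩⟩
    · simp [hδ.le]
    -- If `b = 0`, the whitened points vanish almost surely, contradicting their unit second moment.
    have hb : 0 < b ^ 2 := by
      by_contra hb
      have h1 : ∫ ω, W ⟨0, hnpos⟩ ω a * W ⟨0, hnpos⟩ ω a ∂μ = 1 := by simpa using hcov _ a a
      rw [integral_eq_zero_of_ae] at h1
      · norm_num at h1
      filter_upwards [hWL ⟨0, hnpos⟩] with ω hω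
      have h2 := Finset.single_le_sum
        (f := fun i => W ⟨0, hnpos⟩ ω i * W ⟨0, hnpos⟩ ω i)
        (fun i _ => mul_self_nonneg _) (Finset.mem_univ a)
      have h3 : W ⟨0, hnpos⟩ ω a * W ⟨0, hnpos⟩ ω a ≤ 3 / 2 * b ^ 2 := h2.trans hω
      exact le_antisymm (by simp only [Pi.zero_apply]; linarith) (mul_self_nonneg _)
    -- The constant is `180 = 2 * 60 * (3/2)`: half the sample, the Chernoff rate, and `L = (3/2)
    -- b²`.
    rw [hH, show (n : ℝ) / 2 / (60 * (3 / 2 * b ^ 2)) = n / (180 * b ^ 2) by field_simp; norm_num]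
    exact card_mul_exp_le hcard hd hδ hb hC
  obtain ⟨h, rfl⟩ := hn
  have hc1 : ((firstHalf (h + h)).card : ℝ) = (h + h : ℕ) / 2 := by
    rw [(card_firstHalf_secondHalf h).1]; push_cast; ring
  have hc2 : ((secondHalf (h + h)).card : ℝ) = (h + h : ℕ) / 2 := by
    rw [(card_firstHalf_secondHalf h).2]; push_cast; ring
  have hrange := ae_all_iff.2 (hlaw (ae_transpose_mulVec_mulVec_eq hP hT hTS))
  have hbd := ae_all_iff.2 (hlaw hPb)
  calc μ {ω | ¬ NormBounded (fun i => Z i ω) (3 / √2 * b)}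
      ≤ μ ({ω | ∃ v : ι → ℝ, ∑ j ∈ firstHalf (h + h), (W j ω ⬝ᵥ v) ^ 2 <
            2 / 3 * (firstHalf (h + h)).card * (v ⬝ᵥ v)} ∪
          {ω | ∃ v : ι → ℝ, ∑ j ∈ secondHalf (h + h), (W j ω ⬝ᵥ v) ^ 2 <
            2 / 3 * (secondHalf (h + h)).card * (v ⬝ᵥ v)}) := by
        refine measure_mono_ae ?_
        filter_upwards [hrange, hbd] with ω hr hbω
        refine fun hbad => by_contra fun hgood => hbad ?_
        replace hgood : ω ∉ (_ ∪ _ : Set Ω) := hgood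
        simp only [Set.mem_union, Set.mem_ofPred_eq, not_or, not_exists, not_lt] at hgood
        intro H hH i
        have hHc : (H.card : ℝ) = (h + h : ℕ) / 2 := by rcases hH with rfl | rfl <;> assumption
        have hg : ∀ v : ι → ℝ, 2 / 3 * H.card * (v ⬝ᵥ v) ≤ ∑ j ∈ H, (W j ω ⬝ᵥ v) ^ 2 := by
          rcases hH with rfl | rfl
          exacts [hgood.1, hgood.2]
        -- The factor is `3` because `(2/3) (n/2) = n/3` and `scov` is normalised by `n`.
        have hAB : ∀ v, v ⬝ᵥ secondMoment P *ᵥ v ≤ 3 * (v ⬝ᵥ scov (fun i => Z i ω) H *ᵥ v) := by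
          intro v
          have h1 := hg (T *ᵥ v)
          have h2 : ∀ j, W j ω ⬝ᵥ T *ᵥ v = Z j ω ⬝ᵥ v := by
            intro j
            rw [dotProduct_mulVec, ← mulVec_transpose, hr j]
          simp only [h2, hHc] at h1
          rw [dotProduct_gram_mulVec hT, dotProduct_scov_mulVec]
          rw [show (3 : ℝ) * (1 / ((h + h : ℕ) : ℝ) * ∑ j ∈ H, (Z j ω ⬝ᵥ v) ^ 2) =
            3 * (∑ j ∈ H, (Z j ω ⬝ᵥ v) ^ 2) / ((h + h : ℕ) : ℝ) by ring, le_div_iff₀ hnpos']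
          linarith
        have h3 := dotProduct_pinv_mulVec_le (scov_isHermitian _ H) hS hT (by norm_num) hAB (hr i)
        have h4 : (3 / √2 * b) ^ 2 = 9 / 2 * b ^ 2 := by
          rw [mul_pow, div_pow, Real.sq_sqrt (by norm_num)]; norm_num
        have h5 := hbω i
        rw [h4]
        linarith
    _ ≤ _ := measure_union_le _ _
    _ ≤ ENNReal.ofReal δ + ENNReal.ofReal δ := add_le_add (hbad _ hc1) (hbad _ hc2)
    _ = ENNReal.ofReal (2 * δ) := by rw [← ENNReal.ofReal_add hδ.le hδ.le, two_mul]

/-! ### Second-moment loss under clipping -/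

section Clipping

variable {P : Measure (Fin d → ℝ)} {c : (Fin d → ℝ) → Fin d → ℝ} {b k m : ℝ}

theorem HasMomentBound.integrable_rpow (h : HasMomentBound P k m) (hk : 0 < k) (v : Fin d → ℝ) :
    Integrable (fun z => |v ⬝ᵥ z| ^ k) P := by
  have := (memLp_dotProduct h.1 v).integrable_norm_rpow (by simpa using hk) ENNReal.ofReal_ne_top
  simpa [ENNReal.toReal_ofReal hk.le] using this

theorem HasMomentBound.memLp_two [IsProbabilityMeasure P] (h : HasMomentBound P k m) (hk : 2 ≤ k) :
    MemLp (fun z : Fin d → ℝ => z) 2 P :=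
  h.1.mono_exponent (by rw [← ENNReal.ofReal_ofNat]; exact ENNReal.ofReal_le_ofReal hk)

theorem IsClipping.memLp {A : Matrix (Fin d) (Fin d) ℝ} (hc : IsClipping A b c)
    (hP : MemLp (fun z : Fin d → ℝ => z) 2 P) : MemLp c 2 P := by
  refine hP.of_le hc.1.aestronglyMeasurable (ae_of_all _ fun z => ?_)
  obtain ⟨t, ht0, ht1, ht⟩ := (hc.2.2 z).2
  rw [ht, norm_smul, Real.norm_of_nonneg ht0]
  exact mul_le_of_le_one_left (norm_nonneg _) ht1

/-- Young's inequality for the exponents `k / 2` and `k / (k - 2)`, combined with the power mean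
inequality. -/
theorem sq_mul_rpow_le {ι : Type*} [Fintype ι] [Nonempty ι] {k : ℝ} (hk : 2 < k) {A : ℝ}
    (hA : 0 ≤ A) (x : ι → ℝ) :
    A ^ 2 * (√(x ⬝ᵥ x) / √(Fintype.card ι)) ^ (k - 2) ≤
      2 / k * A ^ k + (k - 2) / k * (1 / (Fintype.card ι : ℝ) * ∑ a, |x a| ^ k) := by
  have hk0 : 0 < k := by linarith
  have hr : (0 : ℝ) < Fintype.card ι := by exact_mod_cast Fintype.card_pos
  set g := √(x ⬝ᵥ x) / √(Fintype.card ι) with hg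
  have hg0 : 0 ≤ g := by positivity
  have h1 := Real.geom_mean_le_arith_mean2_weighted (w₁ := 2 / k) (w₂ := (k - 2) / k)
    (by positivity) (div_nonneg (by linarith) hk0.le) (Real.rpow_nonneg hA k)
    (Real.rpow_nonneg hg0 k) (by field_simp; ring)
  rw [← Real.rpow_mul hA, ← Real.rpow_mul hg0, mul_div_cancel₀ _ hk0.ne',
    mul_div_cancel₀ _ hk0.ne', Real.rpow_two] at h1
  have h2 : g ^ k ≤ 1 / (Fintype.card ι : ℝ) * ∑ a, |x a| ^ k := by
    have h3 := Real.rpow_arith_mean_le_arith_mean_rpow Finset.univ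
      (fun _ : ι => 1 / (Fintype.card ι : ℝ)) (fun a => x a * x a) (fun _ _ => by positivity)
      (by simp) (fun a _ => mul_self_nonneg _) (p := k / 2) (by linarith)
    rw [← Finset.mul_sum, ← Finset.mul_sum] at h3
    have h4 : g ^ k = (1 / (Fintype.card ι : ℝ) * ∑ a, x a * x a) ^ (k / 2) := by
      have h5 : 1 / (Fintype.card ι : ℝ) * ∑ a, x a * x a = g ^ (2 : ℝ) := by
        rw [Real.rpow_two, hg, div_pow, Real.sq_sqrt (dotProduct_self_nonneg_real x),
          Real.sq_sqrt hr.le]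
        simp [dotProduct, div_eq_inv_mul]
      rw [h5, ← Real.rpow_mul hg0]
      congr 1; ring
    have h6 : ∀ a, (x a * x a) ^ (k / 2) = |x a| ^ k := by
      intro a
      rw [← abs_mul_abs_self, ← sq, ← Real.rpow_two, ← Real.rpow_mul (abs_nonneg _)]
      congr 1; ring
    rw [h4]
    simpa only [h6] using h3
  exact h1.trans (add_le_add_right (mul_le_mul_of_nonneg_left h2
    (div_nonneg (by linarith) hk0.le)) _)

/-- Clipping loses at most a third of the second moment in every direction. -/
theorem dotProduct_secondMoment_mulVec_le_map [IsProbabilityMeasure P] (hd : 0 < d) (hk : 2 < k)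
    (hm : 0 ≤ m) (hb : 0 ≤ b) (hP : HasMomentBound P k m)
    (hbm : 3 * m ^ 2 * (m * √(d : ℝ)) ^ (k - 2) ≤ b ^ (k - 2))
    (hc : IsClipping (secondMoment P) b c) (v : Fin d → ℝ) :
    v ⬝ᵥ secondMoment P *ᵥ v ≤ 3 / 2 * (v ⬝ᵥ secondMoment (P.map c) *ᵥ v) := by
  have hk0 : 0 < k := by linarith
  have hP2 := hP.memLp_two hk.le
  have hc2 : MemLp (fun z : Fin d → ℝ => z) 2 (P.map c) :=
    (memLp_map_measure_iff aestronglyMeasurable_id hc.1.aemeasurable).2 (hc.memLp hP2)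
  have hs' : v ⬝ᵥ secondMoment (P.map c) *ᵥ v = ∫ z, (v ⬝ᵥ c z) ^ 2 ∂P := by
    rw [dotProduct_secondMoment_mulVec_self hc2, integral_map hc.1.aemeasurable]
    exact (integrable_dotProduct_sq hc2 v).aestronglyMeasurable
  have hint' : Integrable (fun z => (v ⬝ᵥ c z) ^ 2) P :=
    (integrable_dotProduct_sq hc2 v).comp_measurable hc.1
  have hint := integrable_dotProduct_sq hP2 v
  have hseq := dotProduct_secondMoment_mulVec_self hP2 v
  have hs'0 : 0 ≤ ∫ z, (v ⬝ᵥ c z) ^ 2 ∂P := integral_nonneg fun z => sq_nonneg _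
  rw [hs']
  set s := v ⬝ᵥ secondMoment P *ᵥ v with hs
  rcases le_or_gt s 0 with hs0 | hs0
  · linarith
  -- If `m = 0`, then `v ⬝ᵥ z` vanishes almost everywhere, contradicting `s > 0`.
  have hmpos : 0 < m := by
    refine hm.lt_of_ne fun h0 => hs0.ne' ?_
    have h1 := hP.2 v
    rw [← h0, Real.zero_rpow hk0.ne', zero_mul] at h1
    have h2 : ∫ z, |v ⬝ᵥ z| ^ k ∂P = 0 :=
      le_antisymm h1 (integral_nonneg fun z => Real.rpow_nonneg (abs_nonneg _) _)
    rw [integral_eq_zero_iff_of_nonneg (fun z => Real.rpow_nonneg (abs_nonneg _) _)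
      (hP.integrable_rpow hk0 v)] at h2
    rw [hseq]
    refine integral_eq_zero_of_ae ?_
    filter_upwards [h2] with z hz
    have h3 := (Real.rpow_eq_zero (abs_nonneg (v ⬝ᵥ z)) hk0.ne').1 hz
    simp [abs_eq_zero.1 h3]
  have hd' : (0 : ℝ) < √d := Real.sqrt_pos.2 (by exact_mod_cast hd)
  have hbpos : 0 < b := by
    refine hb.lt_of_ne fun h0 => ?_
    rw [← h0, Real.zero_rpow (by linarith)] at hbm
    have : 0 < 3 * m ^ 2 * (m * √(d : ℝ)) ^ (k - 2) := by positivity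
    linarith
  obtain ⟨ι, _, _, S, T, hcard, hS, hT, hTS⟩ := exists_whitening (secondMoment_posSemidef hP2)
  have hne : Nonempty ι := by
    by_contra hι
    rw [not_nonempty_iff] at hι
    rw [hs, dotProduct_gram_mulVec hT] at hs0
    simp at hs0
  have hr : (0 : ℝ) < Fintype.card ι := by exact_mod_cast Fintype.card_pos
  set r : ℝ := (Fintype.card ι : ℝ) with hrdef
  have hrd : √r ≤ √d := Real.sqrt_le_sqrt (Nat.cast_le.2 hcard)
  have hr' : 0 < √r := Real.sqrt_pos.2 hr
  have hσ : 0 < √s := Real.sqrt_pos.2 hs0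
  -- The right side of `sq_mul_rpow_le` at `A = |v ⬝ᵥ z| / √s` and `x = S *ᵥ z`. Both `v / √s` and
  -- the rows of `S` are unit directions for the second moment, so the mean of `G` is at most `mᵏ`.
  set G : (Fin d → ℝ) → ℝ := fun z => 2 / k * ((√s)⁻¹ ^ k * |v ⬝ᵥ z| ^ k) +
    (k - 2) / k * (1 / r * ∑ a, |S a ⬝ᵥ z| ^ k) with hG
  have hsum_int : Integrable (fun z => ∑ a, |S a ⬝ᵥ z| ^ k) P :=
    integrable_finsetSum _ fun a _ => hP.integrable_rpow hk0 (S a)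
  have hv_int := hP.integrable_rpow hk0 v
  have hGint : Integrable G P :=
    ((hv_int.const_mul _).const_mul _).add ((hsum_int.const_mul _).const_mul _)
  have hGle : ∫ z, G z ∂P ≤ m ^ k := by
    have h1 : (√s)⁻¹ ^ k * ∫ z, |v ⬝ᵥ z| ^ k ∂P ≤ m ^ k := by
      have h2 : s ^ (k / 2) = √s ^ k := by
        rw [Real.sqrt_eq_rpow, ← Real.rpow_mul hs0.le]; congr 1; ring
      have h3 := hP.2 v
      rw [← hs, h2] at h3
      rw [Real.inv_rpow hσ.le, inv_mul_le_iff₀ (by positivity)]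
      linarith
    have h4 : 1 / r * ∫ z, ∑ a, |S a ⬝ᵥ z| ^ k ∂P ≤ m ^ k := by
      rw [integral_finsetSum _ fun a _ => hP.integrable_rpow hk0 (S a)]
      have h5 : ∑ a, ∫ z, |S a ⬝ᵥ z| ^ k ∂P ≤ ∑ _a : ι, m ^ k := by
        refine Finset.sum_le_sum fun a _ => ?_
        have h6 := hP.2 (S a)
        rwa [whitening_mul_mul hT hTS, one_apply_eq, Real.one_rpow, mul_one] at h6
      rw [Finset.sum_const, Finset.card_univ, nsmul_eq_mul] at h5
      rw [one_div, inv_mul_le_iff₀ hr]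
      exact h5
    rw [hG, integral_add ((hv_int.const_mul _).const_mul _) ((hsum_int.const_mul _).const_mul _)]
    simp only [integral_const_mul]
    have h7 : 2 / k + (k - 2) / k = 1 := by field_simp; ring
    have h8 : 0 ≤ 2 / k := by positivity
    have h9 : 0 ≤ (k - 2) / k := div_nonneg (by linarith) hk0.le
    calc _ ≤ 2 / k * m ^ k + (k - 2) / k * m ^ k :=
          add_le_add (mul_le_mul_of_nonneg_left h1 h8) (mul_le_mul_of_nonneg_left h4 h9)
      _ = m ^ k := by rw [← add_mul, h7, one_mul]
  -- The loss is zero inside the ball. Outside it, `1 ≤ (‖z‖ / b) ^ (k - 2)` is inserted and split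
  -- through `√r`, to match `G`.
  have hpt : ∀ z, (v ⬝ᵥ z) ^ 2 - (v ⬝ᵥ c z) ^ 2 ≤ s * (√r / b) ^ (k - 2) * G z := by
    intro z
    have hy := sq_mul_rpow_le hk (A := (√s)⁻¹ * |v ⬝ᵥ z|) (by positivity) (S *ᵥ z)
    rw [Real.mul_rpow (by positivity) (abs_nonneg _)] at hy
    change _ ≤ G z at hy
    have hA2 : ((√s)⁻¹ * |v ⬝ᵥ z|) ^ 2 = s⁻¹ * (v ⬝ᵥ z) ^ 2 := by
      rw [mul_pow, inv_pow, Real.sq_sqrt hs0.le, sq_abs]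
    have hg : psdNorm (secondMoment P) z = √((S *ᵥ z) ⬝ᵥ (S *ᵥ z)) := by
      rw [psdNorm, dotProduct_gram_mulVec hS]
    rw [hA2, ← hg] at hy
    have hg0 : 0 ≤ psdNorm (secondMoment P) z := Real.sqrt_nonneg _
    have hq : 0 ≤ (√r / b) ^ (k - 2) := by positivity
    by_cases hz : psdNorm (secondMoment P) z ≤ b
    · rw [hc.2.1 z hz, sub_self]
      have : 0 ≤ G z := le_trans (by positivity) hy
      positivity
    · push Not at hz
      have h1 : 1 ≤ (psdNorm (secondMoment P) z / √r) ^ (k - 2) * (√r / b) ^ (k - 2) := by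
        rw [← Real.mul_rpow (by positivity) (by positivity)]
        refine Real.one_le_rpow ?_ (by linarith)
        rw [div_mul_div_cancel₀ hr'.ne', one_le_div hbpos]
        exact hz.le
      calc (v ⬝ᵥ z) ^ 2 - (v ⬝ᵥ c z) ^ 2 ≤ (v ⬝ᵥ z) ^ 2 * 1 := by
            nlinarith [sq_nonneg (v ⬝ᵥ c z)]
        _ ≤ (v ⬝ᵥ z) ^ 2 *
            ((psdNorm (secondMoment P) z / √r) ^ (k - 2) * (√r / b) ^ (k - 2)) :=
            mul_le_mul_of_nonneg_left h1 (sq_nonneg _)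
        _ = s * (√r / b) ^ (k - 2) *
            (s⁻¹ * (v ⬝ᵥ z) ^ 2 * (psdNorm (secondMoment P) z / √r) ^ (k - 2)) := by
            field_simp
        _ ≤ _ := mul_le_mul_of_nonneg_left hy (by positivity)
  have hdiff : s - ∫ z, (v ⬝ᵥ c z) ^ 2 ∂P ≤ s * (√r / b) ^ (k - 2) * m ^ k := by
    rw [hseq, ← integral_sub hint hint', ← hseq]
    calc _ ≤ ∫ z, s * (√r / b) ^ (k - 2) * G z ∂P :=
          integral_mono (hint.sub hint') (hGint.const_mul _) hpt
      _ = s * (√r / b) ^ (k - 2) * ∫ z, G z ∂P := integral_const_mul _ _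
      _ ≤ _ := mul_le_mul_of_nonneg_left hGle (by positivity)
  have hthird : (√r / b) ^ (k - 2) * m ^ k ≤ 1 / 3 := by
    have h1 : m ^ k = m ^ 2 * m ^ (k - 2) := by
      rw [← Real.rpow_two, ← Real.rpow_add hmpos]; congr 1; ring
    have h2 : √r ^ (k - 2) ≤ √d ^ (k - 2) :=
      Real.rpow_le_rpow hr'.le hrd (by linarith)
    rw [Real.mul_rpow hm hd'.le] at hbm
    rw [Real.div_rpow hr'.le hb, div_mul_eq_mul_div, div_le_iff₀ (by positivity), h1]
    have h3 := mul_le_mul_of_nonneg_right h2 (show 0 ≤ m ^ 2 * m ^ (k - 2) by positivity)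
    linarith
  have := mul_le_mul_of_nonneg_left hthird hs0.le
  linarith

theorem dotProduct_pinv_mulVec_le_of_psdNorm_le {A : Matrix (Fin d) (Fin d) ℝ} (hA : A.PosSemidef)
    {z : Fin d → ℝ} {b : ℝ} (h : psdNorm A z ≤ b) : z ⬝ᵥ pinv A *ᵥ z ≤ b ^ 2 := by
  obtain ⟨ι, _, _, S, T, -, hS, -, -⟩ := exists_whitening hA
  have h0 : 0 ≤ z ⬝ᵥ pinv A *ᵥ z := by
    rw [dotProduct_gram_mulVec hS]; exact dotProduct_self_nonneg_real _
  exact (Real.sqrt_le_left ((Real.sqrt_nonneg _).trans h)).1 h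

/-- The clipped law is bounded in the norm of its own second moment. -/
theorem ae_map_dotProduct_pinv_mulVec_le [IsProbabilityMeasure P] (hd : 0 < d) (hk : 2 < k)
    (hm : 0 ≤ m) (hb : 0 ≤ b) (hP : HasMomentBound P k m)
    (hbm : 3 * m ^ 2 * (m * √(d : ℝ)) ^ (k - 2) ≤ b ^ (k - 2))
    (hc : IsClipping (secondMoment P) b c) :
    ∀ᵐ z ∂P.map c, z ⬝ᵥ pinv (secondMoment (P.map c)) *ᵥ z ≤ 3 / 2 * b ^ 2 := by
  have hP2 := hP.memLp_two hk.le
  obtain ⟨ι, _, _, S, T, -, hS, hT, hTS⟩ := exists_whitening (secondMoment_posSemidef hP2)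
  have hmeas : MeasurableSet {z : Fin d → ℝ |
      z ⬝ᵥ pinv (secondMoment (P.map c)) *ᵥ z ≤ 3 / 2 * b ^ 2} :=
    (isClosed_le (continuous_id.dotProduct
      (Continuous.matrix_mulVec continuous_const continuous_id)) continuous_const).measurableSet
  rw [ae_map_iff hc.1.aemeasurable hmeas]
  filter_upwards [ae_transpose_mulVec_mulVec_eq hP2 hT hTS] with z hz
  obtain ⟨hcb, t, -, -, ht⟩ := hc.2.2 z
  -- Clipping only rescales, so it keeps `z` in the range of the original second moment.
  have hz' : Tᵀ *ᵥ (S *ᵥ c z) = c z := by rw [ht, mulVec_smul, mulVec_smul, hz]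
  have h1 := dotProduct_pinv_mulVec_le (secondMoment_isHermitian (P.map c)) hS hT (by norm_num)
    (dotProduct_secondMoment_mulVec_le_map hd hk hm hb hP hbm hc) hz'
  have h2 := dotProduct_pinv_mulVec_le_of_psdNorm_le (secondMoment_posSemidef hP2) hcb
  linarith

end Clipping

end HeavyTail

/-! ### The lemma, with constant `180` -/

theorem mainTheorem3 :
    ∃ C : ℝ, 0 < C ∧
      ∀ (d n : ℕ) (δ b : ℝ), 0 < d → Even n → 0 < δ → δ < 1 →
        C * b ^ 2 * Real.log (2 * (d : ℝ) / δ) ≤ (n : ℝ) →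
        ∀ {Ω : Type*} [MeasurableSpace Ω] (μ : Measure Ω) [IsProbabilityMeasure μ]
          (P : Measure (Fin d → ℝ)) [IsProbabilityMeasure P],
          -- the clipped heavy-tailed sample
          (∀ (k m : ℝ) (c : (Fin d → ℝ) → Fin d → ℝ) (Z : Fin n → Ω → Fin d → ℝ),
            2 < k → 0 ≤ m → 0 ≤ b →
            HeavyTail.HasMomentBound P k m →
            3 * m ^ 2 * (m * √(d : ℝ)) ^ (k - 2) ≤ b ^ (k - 2) →
            HeavyTail.IsClipping (HeavyTail.secondMoment P) b c →
            HeavyTail.IsIIDSample Z P μ →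
            μ {ω | ¬ HeavyTail.NormBounded (fun i => c (Z i ω)) (3 / √2 * b)}
              ≤ ENNReal.ofReal (2 * δ)) ∧
          -- any sample whose law is bounded by `√(3/2) b` in the norm of its own second moment
          (∀ Zbar : Fin n → Ω → Fin d → ℝ,
            MemLp (fun z : Fin d → ℝ => z) 2 P →
            (∀ᵐ z ∂P, HeavyTail.psdNorm (HeavyTail.secondMoment P) z ≤ √(3 / 2) * b) →
            HeavyTail.IsIIDSample Zbar P μ →
            μ {ω | ¬ HeavyTail.NormBounded (fun i => Zbar i ω) (3 / √2 * b)}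
              ≤ ENNReal.ofReal (2 * δ)) := by
  refine ⟨180, by norm_num, ?_⟩
  intro d n δ b hd hn hδ _ hC Ω _ μ _ P _
  refine ⟨?_, ?_⟩
  · intro k m c Z hk hm hb hP hbm hc hZ
    have hP2 := hP.memLp_two hk.le
    have hiid : HeavyTail.IsIIDSample (fun i ω => c (Z i ω)) (P.map c) μ :=
      ⟨fun i => hc.1.comp (hZ.1 i),
        fun i => by rw [← hZ.2.1 i, Measure.map_map hc.1 (hZ.1 i)]; rfl,
        hZ.2.2.comp _ fun _ => hc.1⟩
    exact HeavyTail.measure_not_normBounded_le hd hn hδ hC μ (P.map c)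
      ((memLp_map_measure_iff aestronglyMeasurable_id hc.1.aemeasurable).2 (hc.memLp hP2))
      (HeavyTail.ae_map_dotProduct_pinv_mulVec_le hd hk hm hb hP hbm hc) hiid
  · intro Z hP hPb hZ
    refine HeavyTail.measure_not_normBounded_le hd hn hδ hC μ P hP ?_ hZ
    filter_upwards [hPb] with z hz
    have h1 := HeavyTail.dotProduct_pinv_mulVec_le_of_psdNorm_le
      (HeavyTail.secondMoment_posSemidef hP) hz
    rwa [mul_pow, Real.sq_sqrt (by norm_num)] at h1
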